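/- Let $S_{d-1}$ be the unit sphere of $\mathbb{R}^d$ with its normalized surface area $s(\cdot)$, so that $s(S_{d-1})=1$. For $\phi\in[0,\pi]$ let $s_d(\phi)=s(\{y\in S_{d-1}:\langle x,y\rangle\ge\cos\phi\})$ be the normalized area of a spherical cap of angular radius $\phi$; it does not depend on the centre $x\in S_{d-1}$. For $\theta\in(0,\pi/2)$ let $$q(\theta)=\arcsin\left(\frac{\sqrt{(\cos\theta-1)^2(1+2\cos\theta)}}{\sin\theta}\right),\qquad c_\theta=\log\frac{\sin\theta}{\sin q(\theta)} .$$ A finite configuration of points of $S_{d-1}$ is a spherical code of angle $\theta$ if $\langle x,y\rangle\le\cos\theta$ for any two distinct points $x,y$ of it. The grand canonical hard cap model of angle $\theta$ on $S_{d-1}$ at fugacity $\lambda$ is the Poisson point process $\mathbf X$ on $S_{d-1}$ with intensity measure $\lambda s$, conditioned on the event that $\mathbf X$ is a spherical code of angle $\theta$. Let $\alpha_d^\theta(\lambda)$ be the expected number of points of $\mathbf X$ in this model. Theorem. Fix $\theta\in(0,\pi/2)$. There is a sequence $\varepsilon(d)\to 0$ as $d\to\infty$, which depends only on $\theta$ (and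 not on $\lambda$), such that for all integers $d\ge 2$ and all $\lambda\ge\dfrac{1}{d\cdot s_d(q(\theta))}$, $$\alpha_d^\theta(\lambda)\ \ge\ (1+\varepsilon(d))\,\frac{c_\theta\cdot d}{s_d(\theta)} .$$ -/

import Mathlib

open MeasureTheory ProbabilityTheory Filter Topology
open scoped NNReal ENNReal

noncomputable section

namespace HardCap

/-- The unit sphere `S_{d-1}` of `ℝ^d`. -/
abbrev Sph (d : ℕ) : Type := Metric.sphere (0 : EuclideanSpace ℝ (Fin d)) 1

/-- The normalized surface area on the unit sphere of `ℝ^d`. -/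
def surf (d : ℕ) : Measure (Sph d) :=
  ((volume : Measure (EuclideanSpace ℝ (Fin d))).toSphere Set.univ)⁻¹ •
    (volume : Measure (EuclideanSpace ℝ (Fin d))).toSphere

/-- The closed spherical cap `C_θ(x)` of angular radius `θ` around the unit vector `x`. -/
def cap {d : ℕ} (θ : ℝ) (x : Sph d) : Set (Sph d) :=
  {y | Real.cos θ ≤ inner ℝ (x : EuclideanSpace ℝ (Fin d)) (y : EuclideanSpace ℝ (Fin d))}

/-- The first standard basis vector, as a point of the unit sphere of `ℝ^d` for `d ≥ 1`. -/
def pole (d : ℕ) (hd : 0 < d) : Sph d :=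
  ⟨EuclideanSpace.single ⟨0, hd⟩ 1, by simp⟩

/-- The normalized surface area `s_d(θ)` of a spherical cap of angular radius `θ` in dimension
`d ≥ 1`, computed at one centre; `capArea_eq` below shows that the centre does not matter.
(The sphere is empty for `d = 0`; the value is then `0`.) -/
def capArea (d : ℕ) (θ : ℝ) : ℝ :=
  if hd : 0 < d then (surf d).real (cap θ (pole d hd)) else 0

section

open Set
open scoped Pointwise

/-- All caps of the same angular radius have the same normalized surface area. -/
theorem surf_cap_eq {d : ℕ} (θ : ℝ) (x y : Sph d) :
    surf d (cap θ x) = surf d (cap θ y) := by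
  have hm : ∀ z : Sph d, MeasurableSet (cap θ z) := fun z =>
    measurableSet_le measurable_const
      ((continuous_const.inner continuous_subtype_val).measurable)
  set f : EuclideanSpace ℝ (Fin d) ≃ₗᵢ[ℝ] EuclideanSpace ℝ (Fin d) :=
    (ℝ ∙ ((x : EuclideanSpace ℝ (Fin d)) - y))ᗮ.reflection with hf
  have hfx : f x = y := Submodule.reflection_sub (by simp)
  have hfy : f.symm y = x := by rw [← hfx]; simp
  have key : f ⁻¹' (Ioo (0 : ℝ) 1 • (((↑) : Sph d → EuclideanSpace ℝ (Fin d)) '' cap θ y)) =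
      Ioo (0 : ℝ) 1 • (((↑) : Sph d → EuclideanSpace ℝ (Fin d)) '' cap θ x) := by
    ext v
    simp only [mem_preimage, Set.mem_smul]
    constructor
    · rintro ⟨r, hr, _, ⟨z, hz, rfl⟩, h⟩
      refine ⟨r, hr, f.symm z, ⟨⟨f.symm z, by simp⟩, ?_, rfl⟩, ?_⟩
      · change _ ≤ inner ℝ (x : EuclideanSpace ℝ (Fin d)) (f.symm z)
        rw [← hfy, LinearIsometryEquiv.inner_map_map]
        exact hz
      · change r • (z : EuclideanSpace ℝ (Fin d)) = f v at h
        rw [← map_smul, h]; simp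
    · rintro ⟨r, hr, _, ⟨z, hz, rfl⟩, rfl⟩
      refine ⟨r, hr, f z, ⟨⟨f z, by simp⟩, ?_, rfl⟩, ?_⟩
      · change _ ≤ inner ℝ (y : EuclideanSpace ℝ (Fin d)) (f z)
        rw [← hfx, LinearIsometryEquiv.inner_map_map]
        exact hz
      · simp
  simp only [surf, Measure.smul_apply, smul_eq_mul]
  rw [Measure.toSphere_apply' _ (hm x), Measure.toSphere_apply' _ (hm y), ← key,
    f.measurePreserving.measure_preimage_emb f.toHomeomorph.measurableEmbedding]

/-- The cap area can be computed at any centre. -/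
theorem capArea_eq {d : ℕ} (θ : ℝ) (x : Sph d) : capArea d θ = (surf d).real (cap θ x) := by
  have hd : 0 < d := by
    rcases Nat.eq_zero_or_pos d with rfl | h
    · have h1 : ‖(x : EuclideanSpace ℝ (Fin 0))‖ = 1 := by simp
      rw [Subsingleton.elim (x : EuclideanSpace ℝ (Fin 0)) 0, norm_zero] at h1
      exact absurd h1 zero_ne_one
    · exact h
  rw [capArea, dif_pos hd, Measure.real, Measure.real, surf_cap_eq θ _ x]

end

/-- The angular radius `q(θ)` of the smallest spherical cap that contains the intersection of two
caps of angular radius `θ` whose centres are at angle `θ`. -/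
def q (θ : ℝ) : ℝ :=
  Real.arcsin (√((Real.cos θ - 1) ^ 2 * (1 + 2 * Real.cos θ)) / Real.sin θ)

/-- The constant `c_θ = log (sin θ / sin q(θ))`. -/
def c (θ : ℝ) : ℝ := Real.log (Real.sin θ / Real.sin (q θ))

/-- Finite point configurations on the sphere: a number `k` and a list of `k` points. -/
abbrev Config (d : ℕ) : Type := Σ k : ℕ, (Fin k → Sph d)

/-- The configurations that are spherical codes of angle `θ`. For `0 < θ < π` the points of such
a configuration are automatically distinct, so its size is the length `k` of the list. -/
def codes (d : ℕ) (θ : ℝ) : Set (Config d) :=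
  {X | ∀ i j : Fin X.1, i ≠ j →
    inner ℝ (X.2 i : EuclideanSpace ℝ (Fin d)) (X.2 j : EuclideanSpace ℝ (Fin d)) ≤ Real.cos θ}

/-- The law of the Poisson point process of intensity `lam` on the sphere, with normalized surface
area as the underlying measure: the number `k` of points has the Poisson distribution with mean
`lam`, and given `k` the points are independent and uniformly distributed. -/
def poissonProcess (d : ℕ) (lam : ℝ≥0) : Measure (Config d) :=
  Measure.sum fun k : ℕ =>
    poissonMeasure lam {k} • (Measure.pi fun _ : Fin k => surf d).map (fun x => (⟨k, x⟩ : Config d))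

/-- The law of the grand canonical hard cap model at fugacity `lam`: the Poisson process of
intensity `lam` conditioned on being a spherical code of angle `θ`. -/
def hardCap (d : ℕ) (θ : ℝ) (lam : ℝ≥0) : Measure (Config d) :=
  ProbabilityTheory.cond (poissonProcess d lam) (codes d θ)

/-- The expected size `α_d^θ(lam)` of a random spherical code drawn from the hard cap model. -/
def expectedSize (d : ℕ) (θ : ℝ) (lam : ℝ≥0) : ℝ :=
  ∫ X, (X.1 : ℝ) ∂(hardCap d θ lam)

end HardCap

end

/-! The engine is a lower bound for the mean number of points of a hard core model given by a
symmetric conflict relation. Fix a point `v` and let `T` be the part of its conflict region that the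
points outside this region leave free (`freeRegion`). Given the outside, the points inside form a
hard core model on `T`. Put `w = lam * μ T`. The conflict region of `v` is empty with probability at
least `E exp (-w)`, since the hard core partition function on `T` is at most the Poisson one
(`gcSum_exp_le`). It contains at least `κ * E w` points on average once the mean overlap inside `T`
is small, `lam * b ≤ 1 - κ` (`gcSum_freeRegion_le_of_lt`). Linearise the exponential at a free
parameter `t` and average over `v`: the first quantity becomes `α / lam`, the mean number of
conflicts becomes at most `s * α`, and so `exp (-t) * (1 + t) * lam ≤ (1 + exp (-t) * κ⁻¹ * lam * s)
* α` (`gcSum_code_le_gcSum_size`). No conditional law is constructed: everything is an inequality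
between sums `gcSum`, obtained from Mecke's formula `gcSum_palmSum` and a Stein equation.

Geometry enters twice. On the sphere `b` can be twice the area of a cap of radius `q θ`: charge each
conflicting pair in `T` to the point farther from `v`; the other one then lies in a lens inside such
a cap (`lintegral_measure_inter_le`, `exists_lens_subset_cap`). Moreover the area of a cap of radius
`φ` is `sin φ ^ d` up to subexponential factors, so the areas for `q θ` and `θ` have ratio `exp (-(c
θ + o(1)) * d)` (`tendsto_exp_mul_capArea_div`). At the threshold fugacity `κ = 1 - 2 / d`, and `t`
slightly below `c θ * d` makes the term without `s` negligible, which gives the bound. Larger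
fugacities follow by monotonicity (`expectedSize_mono`), so the error depends on `d` and `θ` only.
-/

noncomputable section

namespace HardCap

/-! ### Codes, free points and conflicts for an abstract relation -/

section GrandCanonical

variable {S : Type*}

open Classical in
/-- The `ℝ≥0∞`-valued indicator of a proposition. -/
def ind (p : Prop) : ℝ≥0∞ := if p then 1 else 0

theorem ind_of_true {p : Prop} (h : p) : ind p = 1 := if_pos h

theorem ind_of_false {p : Prop} (h : ¬p) : ind p = 0 := if_neg h

theorem ind_and (p r : Prop) : ind (p ∧ r) = ind p * ind r := by
  by_cases hp : p <;> by_cases hr : r <;> simp [ind, hp, hr]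

theorem ind_le_one (p : Prop) : ind p ≤ 1 := by
  by_cases hp : p <;> simp [ind, hp]

theorem measurable_ind {A : Type*} [MeasurableSpace A] {p : A → Prop}
    (h : MeasurableSet {a | p a}) : Measurable fun a => ind (p a) := by
  classical
  exact Measurable.ite h measurable_const measurable_const

theorem lintegral_ind [MeasurableSpace S] (μ : Measure S) {p : S → Prop}
    (h : MeasurableSet {a | p a}) : ∫⁻ a, ind (p a) ∂μ = μ {a | p a} := by
  classical
  rw [← lintegral_indicator_one h]
  rfl

theorem lintegral_ind_mem [MeasurableSpace S] (μ : Measure S) {T : Set S}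
    (h : MeasurableSet T) : ∫⁻ a, ind (a ∈ T) ∂μ = μ T :=
  lintegral_ind μ h

/-- A tuple of points no two of which are in conflict. -/
def IsCode (R : S → S → Prop) {n : ℕ} (x : Fin n → S) : Prop :=
  ∀ i j, i ≠ j → ¬R (x i) (x j)

/-- The point `y` is in conflict with no point of the tuple `x`. -/
def IsFree (R : S → S → Prop) {n : ℕ} (x : Fin n → S) (y : S) : Prop :=
  ∀ i, ¬R y (x i)

/-- The points in conflict with `v` that the points of `x` outside the conflict region of `v`
leave free. -/
def freeRegion (R : S → S → Prop) (v : S) {n : ℕ} (x : Fin n → S) : Set S :=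
  {y | R v y ∧ ∀ i, ¬R v (x i) → ¬R y (x i)}

open Classical in
/-- The number of points of `x` in conflict with `v`. -/
def conflicts (R : S → S → Prop) (v : S) {n : ℕ} (x : Fin n → S) : ℕ :=
  ∑ i, if R v (x i) then 1 else 0

theorem natCast_conflicts (R : S → S → Prop) (v : S) {n : ℕ} (x : Fin n → S) :
    (conflicts R v x : ℝ≥0∞) = ∑ i, ind (R v (x i)) := by
  simp [conflicts, ind]

theorem conflicts_eq_zero_iff (R : S → S → Prop) (v : S) {n : ℕ} (x : Fin n → S) :
    conflicts R v x = 0 ↔ IsFree R x v := by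
  simp [conflicts, IsFree]

/-- This splitting off of one point is what makes Mecke's formula applicable to sums over the points
of a code. -/
theorem isCode_iff_removeNth {R : S → S → Prop} (hsymm : ∀ a b, R a b → R b a) {n : ℕ}
    (x : Fin (n + 1) → S) (i : Fin (n + 1)) :
    IsCode R x ↔ IsCode R (i.removeNth x) ∧ IsFree R (i.removeNth x) (x i) := by
  constructor
  · intro h
    exact ⟨fun j k hjk => h _ _ (fun e => hjk (Fin.succAbove_right_injective e)),
      fun j => h _ _ (Fin.succAbove_ne i j).symm⟩
  · rintro ⟨h1, h2⟩ j k hjk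
    rcases Fin.eq_self_or_eq_succAbove i j with rfl | ⟨j, rfl⟩
    · rcases Fin.eq_self_or_eq_succAbove j k with rfl | ⟨k, rfl⟩
      · exact absurd rfl hjk
      · exact h2 k
    · rcases Fin.eq_self_or_eq_succAbove i k with rfl | ⟨k, rfl⟩
      · exact fun h => h2 j (hsymm _ _ h)
      · exact h1 j k (fun e => hjk (by rw [e]))

/-- The free region depends only on the points outside the conflict region of `v`; this replaces
conditioning on the outside. -/
theorem freeRegion_removeNth {R : S → S → Prop} {v : S} {n : ℕ} {x : Fin (n + 1) → S}
    {i : Fin (n + 1)} (h : R v (x i)) :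
    freeRegion R v (i.removeNth x) = freeRegion R v x := by
  ext y
  simp only [freeRegion, Set.mem_ofPred_eq, Fin.forall_iff_succAbove i, Fin.removeNth_apply]
  tauto

theorem conflicts_removeNth {R : S → S → Prop} {v : S} {n : ℕ} {x : Fin (n + 1) → S}
    {i : Fin (n + 1)} (h : R v (x i)) :
    conflicts R v x = conflicts R v (i.removeNth x) + 1 := by
  rw [conflicts, Fin.sum_univ_succAbove _ i, if_pos h, add_comm]
  rfl

theorem mem_freeRegion_of_isFree {R : S → S → Prop} {v y : S} {n : ℕ} {x : Fin n → S}
    (hv : R v y) (h : IsFree R x y) : y ∈ freeRegion R v x :=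
  ⟨hv, fun i _ => h i⟩

variable [MeasurableSpace S]

/-! ### Measurability of the code events and counts -/

section Measurability

variable {A : Type*} [MeasurableSpace A] {R : S → S → Prop}

theorem measurableSet_rel (hR : MeasurableSet {p : S × S | R p.1 p.2}) {f g : A → S}
    (hf : Measurable f) (hg : Measurable g) : MeasurableSet {a | R (f a) (g a)} :=
  (hf.prodMk hg) hR

theorem measurableSet_isCode (hR : MeasurableSet {p : S × S | R p.1 p.2}) {n : ℕ}
    {x : A → Fin n → S} (hx : Measurable x) : MeasurableSet {a | IsCode R (x a)} := by
  have hi : ∀ i, Measurable fun a => x a i := fun i => (measurable_pi_apply i).comp hx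
  simp only [IsCode, Set.ofPred_forall]
  exact .iInter fun i => .iInter fun j => .iInter fun _ =>
    (measurableSet_rel hR (hi i) (hi j)).compl

theorem measurableSet_isFree (hR : MeasurableSet {p : S × S | R p.1 p.2}) {n : ℕ}
    {x : A → Fin n → S} {y : A → S} (hx : Measurable x) (hy : Measurable y) :
    MeasurableSet {a | IsFree R (x a) (y a)} := by
  have hi : ∀ i, Measurable fun a => x a i := fun i => (measurable_pi_apply i).comp hx
  simp only [IsFree, Set.ofPred_forall]
  exact .iInter fun i => (measurableSet_rel hR hy (hi i)).compl

theorem measurableSet_freeRegion (hR : MeasurableSet {p : S × S | R p.1 p.2}) {n : ℕ}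
    {x : A → Fin n → S} {y v : A → S} (hx : Measurable x) (hy : Measurable y)
    (hv : Measurable v) :
    MeasurableSet {a | y a ∈ freeRegion R (v a) (x a)} := by
  have hi : ∀ i, Measurable fun a => x a i := fun i => (measurable_pi_apply i).comp hx
  have h : {a | y a ∈ freeRegion R (v a) (x a)} = {a | R (v a) (y a)} ∩
      ⋂ i, ({a | R (v a) (x a i)} ∪ {a | R (y a) (x a i)}ᶜ) := by
    ext a
    simp [freeRegion, or_iff_not_imp_left]
  rw [h]
  exact (measurableSet_rel hR hv hy).inter (.iInter fun i =>
    (measurableSet_rel hR hv (hi i)).union (measurableSet_rel hR hy (hi i)).compl)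

theorem measurable_conflicts (hR : MeasurableSet {p : S × S | R p.1 p.2}) {n : ℕ}
    {x : A → Fin n → S} {v : A → S} (hx : Measurable x) (hv : Measurable v) :
    Measurable fun a => conflicts R (v a) (x a) := by
  classical
  have hi : ∀ i, Measurable fun a => x a i := fun i => (measurable_pi_apply i).comp hx
  unfold conflicts
  exact Finset.measurable_sum _ fun i _ =>
    Measurable.ite (measurableSet_rel hR hv (hi i)) measurable_const measurable_const

end Measurability

/-! ### Grand canonical sums and Mecke's formula -/

/-- The sum over `n` of `lam ^ n / n!` times the integral of `f n` over `n`-tuples of points: the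
unnormalized expectation of `f` over the Poisson process of intensity `lam • μ`. -/
def gcSum (μ : Measure S) (lam : ℝ≥0∞) (f : ∀ n, (Fin n → S) → ℝ≥0∞) : ℝ≥0∞ :=
  ∑' n : ℕ, lam ^ n / (n.factorial : ℝ≥0∞) * ∫⁻ x, f n x ∂Measure.pi fun _ => μ

variable {μ : Measure S} {lam : ℝ≥0∞} {f g : ∀ n, (Fin n → S) → ℝ≥0∞}

theorem gcSum_mono (h : ∀ n x, f n x ≤ g n x) : gcSum μ lam f ≤ gcSum μ lam g :=
  ENNReal.tsum_le_tsum fun n => by gcongr; exact h n _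

theorem gcSum_congr (h : ∀ n x, f n x = g n x) : gcSum μ lam f = gcSum μ lam g :=
  congrArg _ (funext fun n => funext fun x => h n x)

theorem gcSum_add (hf : ∀ n, Measurable (f n)) :
    gcSum μ lam (fun n x => f n x + g n x) = gcSum μ lam f + gcSum μ lam g := by
  simp only [gcSum]
  rw [← ENNReal.tsum_add]
  congr with n
  rw [lintegral_add_left (hf n), mul_add]

theorem gcSum_const_mul (r : ℝ≥0∞) (hf : ∀ n, Measurable (f n)) :
    gcSum μ lam (fun n x => r * f n x) = r * gcSum μ lam f := by
  simp only [gcSum]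
  rw [← ENNReal.tsum_mul_left]
  congr with n
  rw [lintegral_const_mul _ (hf n), mul_left_comm]

theorem lintegral_gcSum {f : S → ∀ n, (Fin n → S) → ℝ≥0∞} [SigmaFinite μ]
    (hf : ∀ n, Measurable fun p : S × (Fin n → S) => f p.1 n p.2) :
    ∫⁻ v, gcSum μ lam (f v) ∂μ = gcSum μ lam fun n x => ∫⁻ v, f v n x ∂μ := by
  simp only [gcSum]
  rw [lintegral_tsum fun n => ((hf n).lintegral_prod_right').aemeasurable.const_mul _]
  congr with n
  rw [lintegral_const_mul _ (hf n).lintegral_prod_right',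
    lintegral_lintegral_swap (hf n).aemeasurable]

/-- The sum over the points of a configuration of a function of that point and of the others. -/
def palmSum (G : ∀ n, (Fin n → S) → S → ℝ≥0∞) : ∀ n, (Fin n → S) → ℝ≥0∞
  | 0, _ => 0
  | n + 1, x => ∑ i, G n (i.removeNth x) (x i)

/-- Mecke's formula. -/
theorem gcSum_palmSum [SigmaFinite μ] {G : ∀ n, (Fin n → S) → S → ℝ≥0∞}
    (hG : ∀ n, Measurable fun p : (Fin n → S) × S => G n p.1 p.2) :
    gcSum μ lam (palmSum G) = lam * gcSum μ lam fun n x => ∫⁻ y, G n x y ∂μ := by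
  simp only [gcSum]
  rw [tsum_eq_zero_add' ENNReal.summable, ← ENNReal.tsum_mul_left]
  simp only [palmSum, lintegral_zero, mul_zero, zero_add]
  congr with n
  -- By symmetry of the product measure each of the `n + 1` points contributes equally; the factor
  -- `n + 1` turns `1 / (n + 1)!` into `1 / n!`.
  have key : ∀ i : Fin (n + 1),
      ∫⁻ x, G n (i.removeNth x) (x i) ∂(Measure.pi fun _ : Fin (n + 1) => μ) =
        ∫⁻ x, ∫⁻ y, G n x y ∂μ ∂(Measure.pi fun _ : Fin n => μ) := fun i => by
    have hG' : Measurable fun p : S × (Fin n → S) => G n p.2 p.1 :=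
      (hG n).comp measurable_swap
    rw [← lintegral_prod_symm' _ hG',
      ← (measurePreserving_piFinSuccAbove (fun _ : Fin (n + 1) => μ) i).lintegral_comp hG']
    rfl
  have hm : ∀ i : Fin (n + 1), Measurable fun x : Fin (n + 1) → S =>
      G n (i.removeNth x) (x i) := fun i =>
    (hG n).comp (Measurable.prodMk
      (measurable_pi_lambda _ fun j => measurable_pi_apply _) (measurable_pi_apply i))
  rw [lintegral_finsetSum _ fun i _ => hm i]
  simp only [key, Finset.sum_const, Finset.card_univ, Fintype.card_fin, nsmul_eq_mul]
  rw [← mul_assoc, ← mul_assoc]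
  congr 1
  rw [Nat.factorial_succ, pow_succ', Nat.cast_mul, ENNReal.div_eq_inv_mul, ENNReal.div_eq_inv_mul,
    ENNReal.mul_inv (by simp) (by simp)]
  have h1 : ((n + 1 : ℕ) : ℝ≥0∞)⁻¹ * ((n + 1 : ℕ) : ℝ≥0∞) = 1 :=
    ENNReal.inv_mul_cancel (by simp) (by simp)
  calc _ = ((n + 1 : ℕ) : ℝ≥0∞)⁻¹ * ((n + 1 : ℕ) : ℝ≥0∞) *
        (((n.factorial : ℕ) : ℝ≥0∞)⁻¹ * (lam * lam ^ n)) := by ring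
    _ = _ := by rw [h1]; ring

end GrandCanonical

/-! ### Stein equation for the Poisson void probability -/

section Stein

/-- The solution of the Stein equation of the Poisson distribution with mean `w` for the event
that there is no point. -/
def stein (N : ℕ) (w : ℝ) : ℝ := ∫ u in (0 : ℝ)..1, u ^ N * Real.exp (-(u * w))

theorem stein_nonneg (N : ℕ) (w : ℝ) : 0 ≤ stein N w :=
  intervalIntegral.integral_nonneg zero_le_one fun _ hu =>
    mul_nonneg (pow_nonneg hu.1 _) (Real.exp_pos _).le

theorem stein_le_one (N : ℕ) {w : ℝ} (hw : 0 ≤ w) : stein N w ≤ 1 := by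
  have h : stein N w ≤ ∫ u in (0 : ℝ)..1, (1 : ℝ) := by
    refine intervalIntegral.integral_mono_on zero_le_one
      (Continuous.intervalIntegrable (by fun_prop) _ _) (by simp) fun u hu => ?_
    refine mul_le_one₀ (pow_le_one₀ hu.1 hu.2) (Real.exp_pos _).le ?_
    rw [Real.exp_le_one_iff]
    linarith [mul_nonneg hu.1 hw]
  simpa using h

theorem measurable_stein (N : ℕ) : Measurable (stein N) := by
  refine Continuous.measurable ?_
  unfold stein
  exact intervalIntegral.continuous_parametric_intervalIntegral_of_continuous' (by fun_prop) _ _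

/-- Integrate the derivative of `u ^ N * exp (-(u * w))` over `[0, 1]`. For `N = 0` the truncated `N
- 1` is harmless, as its term has the factor `0`. -/
theorem stein_equation (N : ℕ) (w : ℝ) :
    0 ^ N + N * stein (N - 1) w = Real.exp (-w) + w * stein N w := by
  have hd : ∀ u : ℝ, HasDerivAt (fun u : ℝ => u ^ N * Real.exp (-(u * w)))
      (N * (u ^ (N - 1) * Real.exp (-(u * w))) - w * (u ^ N * Real.exp (-(u * w)))) u := by
    intro u
    have h1 : HasDerivAt (fun u : ℝ => Real.exp (-(u * w))) (Real.exp (-(u * w)) * -(1 * w)) u :=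
      ((hasDerivAt_id u).mul_const w).neg.exp
    exact ((hasDerivAt_pow N u).fun_mul h1).congr_deriv (by ring)
  have h := intervalIntegral.integral_eq_sub_of_hasDerivAt (a := 0) (b := 1)
    (fun u _ => hd u) (Continuous.intervalIntegrable (by fun_prop) _ _)
  rw [intervalIntegral.integral_sub (Continuous.intervalIntegrable (by fun_prop) _ _)
    (Continuous.intervalIntegrable (by fun_prop) _ _), intervalIntegral.integral_const_mul,
    intervalIntegral.integral_const_mul] at h
  simp only [one_pow, one_mul, zero_mul, neg_zero, Real.exp_zero, mul_one] at h
  unfold stein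
  linarith

end Stein

/-! ### Void probabilities and occupancy in the hard core model -/

section GrandCanonical

variable {S : Type*} [MeasurableSpace S] {μ : Measure S} [IsProbabilityMeasure μ] {lam : ℝ≥0∞}
  {R : S → S → Prop}

theorem gcSum_one_ne_top (hlam : lam ≠ ∞) : gcSum μ lam (fun _ _ => 1) ≠ ∞ := by
  lift lam to ℝ≥0 using hlam
  have h : ∀ n : ℕ, (lam : ℝ≥0∞) ^ n / (n.factorial : ℝ≥0∞) *
      ∫⁻ _ : Fin n → S, 1 ∂Measure.pi (fun _ => μ) = ((lam ^ n / n.factorial : ℝ≥0) : ℝ≥0∞) := by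
    intro n
    rw [lintegral_const, measure_univ, mul_one, mul_one,
      ENNReal.coe_div (by positivity)]
    simp
  simp only [gcSum, h]
  rw [ENNReal.tsum_coe_ne_top_iff_summable, ← NNReal.summable_coe]
  simpa using Real.summable_pow_div_factorial (lam : ℝ)

/-- Needed to cancel terms in `ℝ≥0∞`. -/
theorem gcSum_ne_top (hlam : lam ≠ ∞) {f : ∀ n, (Fin n → S) → ℝ≥0∞} {K : ℝ≥0∞} (hK : K ≠ ∞)
    (h : ∀ n x, f n x ≤ K) : gcSum μ lam f ≠ ∞ := by
  refine ne_top_of_le_ne_top (ENNReal.mul_ne_top hK (gcSum_one_ne_top (μ := μ) hlam)) ?_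
  rw [← gcSum_const_mul _ fun n => measurable_const]
  exact gcSum_mono fun n x => by simpa using h n x

theorem measurable_ind_isCode (hR : MeasurableSet {p : S × S | R p.1 p.2}) (n : ℕ) :
    Measurable fun x : Fin n → S => ind (IsCode R x) :=
  measurable_ind (measurableSet_isCode hR measurable_id)

theorem measurableSet_freeRegion_apply (hR : MeasurableSet {p : S × S | R p.1 p.2}) (v : S)
    {n : ℕ} (x : Fin n → S) : MeasurableSet (freeRegion R v x) :=
  measurableSet_freeRegion (A := S) hR measurable_const measurable_id measurable_const

theorem measurable_measure_freeRegion (hR : MeasurableSet {p : S × S | R p.1 p.2}) (v : S)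
    (n : ℕ) : Measurable fun x : Fin n → S => μ (freeRegion R v x) :=
  measurable_measure_prodMk_left (ν := μ) (s := {p : (Fin n → S) × S | p.2 ∈ freeRegion R v p.1})
    (measurableSet_freeRegion hR measurable_fst measurable_snd measurable_const)

/-- A code has no point in the conflict region of `v` with at least the probability that a Poisson
process has no point in the region left free. -/
theorem gcSum_exp_le (hR : MeasurableSet {p : S × S | R p.1 p.2}) (hsymm : ∀ a b, R a b → R b a)
    (hlam : lam ≠ ∞) (v : S) :
    gcSum μ lam (fun _ x => ind (IsCode R x) *
        ENNReal.ofReal (Real.exp (-(lam * μ (freeRegion R v x)).toReal))) ≤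
      gcSum μ lam (fun _ x => ind (IsCode R x) * ind (IsFree R x v)) := by
  set C : ∀ n, (Fin n → S) → ℝ≥0∞ := fun _ x => ind (IsCode R x) with hC
  set W : ∀ n, (Fin n → S) → ℝ := fun _ x => (lam * μ (freeRegion R v x)).toReal with hW
  set H : ∀ n, (Fin n → S) → ℝ≥0∞ := fun n x =>
    ENNReal.ofReal (stein (conflicts R v x) (W n x)) with hH
  set H' : ∀ n, (Fin n → S) → ℝ≥0∞ := fun n x =>
    (conflicts R v x : ℝ≥0∞) * ENNReal.ofReal (stein (conflicts R v x - 1) (W n x)) with hH'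
  have hWtop : ∀ n (x : Fin n → S), lam * μ (freeRegion R v x) ≠ ∞ := fun n x =>
    ENNReal.mul_ne_top hlam (measure_ne_top _ _)
  have hW0 : ∀ n x, 0 ≤ W n x := fun n x => ENNReal.toReal_nonneg
  have hCm : ∀ n, Measurable (C n) := measurable_ind_isCode hR
  have hWm : ∀ n, Measurable (W n) := fun n =>
    ((measurable_measure_freeRegion hR v n).const_mul lam).ennreal_toReal
  have hNm : ∀ n, Measurable fun x : Fin n → S => conflicts R v x := fun n =>
    measurable_conflicts hR measurable_id measurable_const
  have hsm : ∀ n (k : ℕ → ℕ),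
      Measurable fun x : Fin n → S => stein (k (conflicts R v x)) (W n x) := fun n k =>
    (measurable_from_prod_countable_right (f := fun p : ℕ × ℝ => stein (k p.1) p.2)
      fun N => measurable_stein (k N)).comp ((hNm n).prodMk (hWm n))
  have hHm : ∀ n, Measurable (H n) := fun n => (hsm n id).ennreal_ofReal
  have hH'm : ∀ n, Measurable (H' n) := fun n =>
    ((Measurable.of_discrete (f := fun k : ℕ => (k : ℝ≥0∞))).comp (hNm n)).mul
      (hsm n (· - 1)).ennreal_ofReal
  have hfm : ∀ n, Measurable fun x : Fin n → S => ind (IsFree R x v) := fun n =>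
    measurable_ind (measurableSet_isFree hR measurable_id measurable_const)
  -- The Stein equation with `N` the number of conflicts with `v` and `w = lam * μ T`; `0 ^ N` is
  -- the indicator that `v` is free.
  have hid : ∀ n x, C n x * ind (IsFree R x v) + C n x * H' n x =
      C n x * ENNReal.ofReal (Real.exp (-W n x)) +
        C n x * (lam * μ (freeRegion R v x) * H n x) := by
    intro n x
    have h0 : ind (IsFree R x v) = ENNReal.ofReal (0 ^ conflicts R v x) := by
      by_cases h : IsFree R x v
      · rw [ind_of_true h, (conflicts_eq_zero_iff R v x).2 h]
        simp
      · rw [ind_of_false h, zero_pow (mt (conflicts_eq_zero_iff R v x).1 h)]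
        simp
    have h1 : lam * μ (freeRegion R v x) = ENNReal.ofReal (W n x) :=
      (ENNReal.ofReal_toReal (hWtop n x)).symm
    have h2 : (conflicts R v x : ℝ≥0∞) = ENNReal.ofReal (conflicts R v x : ℝ) := by simp
    rw [← mul_add, ← mul_add]
    congr 1
    simp only [hH, hH']
    rw [h0, h1, h2, ← ENNReal.ofReal_mul (by positivity), ← ENNReal.ofReal_mul (hW0 n x),
      ← ENNReal.ofReal_add (by positivity)
        (mul_nonneg (by positivity) (stein_nonneg _ _)),
      ← ENNReal.ofReal_add (Real.exp_pos _).le (mul_nonneg (hW0 n x) (stein_nonneg _ _)),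
      stein_equation]
  have hsum : gcSum μ lam (fun n x => C n x * ind (IsFree R x v)) +
        gcSum μ lam (fun n x => C n x * H' n x) =
      gcSum μ lam (fun n x => C n x * ENNReal.ofReal (Real.exp (-W n x))) +
        gcSum μ lam (fun n x => C n x * (lam * μ (freeRegion R v x) * H n x)) := by
    have h1 : ∀ n, Measurable fun x => C n x * ind (IsFree R x v) := fun n => (hCm n).mul (hfm n)
    have h2 : ∀ n, Measurable fun x => C n x * ENNReal.ofReal (Real.exp (-W n x)) := fun n =>
      (hCm n).mul (Real.measurable_exp.comp (hWm n).neg).ennreal_ofReal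
    rw [← gcSum_add h1, ← gcSum_add h2]
    exact gcSum_congr hid
  have hH1 : ∀ n x, H n x ≤ 1 := fun n x => by
    simpa [hH] using stein_le_one _ (hW0 n x)
  -- Removing a point of a code in conflict with `v` keeps `T`, lowers `N` by one, and the removed
  -- point lies in `T`. Only an inequality results, because adding a point of `T` need not give a
  -- code.
  have hle : gcSum μ lam (fun n x => C n x * H' n x) ≤
      gcSum μ lam (fun n x => C n x * (lam * μ (freeRegion R v x) * H n x)) := by
    calc gcSum μ lam (fun n x => C n x * H' n x)
        ≤ gcSum μ lam (palmSum fun n x y => C n x * H n x * ind (y ∈ freeRegion R v x)) := by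
          refine gcSum_mono fun n x => ?_
          cases n with
          | zero => simp [hH', conflicts]
          | succ n =>
            simp only [hH', natCast_conflicts, palmSum, Finset.sum_mul, Finset.mul_sum]
            refine Finset.sum_le_sum fun i _ => ?_
            by_cases hc : IsCode R x
            · by_cases hi : R v (x i)
              · obtain ⟨h1, h2⟩ := (isCode_iff_removeNth hsymm x i).1 hc
                simp only [hC, hH, hW, freeRegion_removeNth hi, conflicts_removeNth hi,
                  ind_of_true hi, ind_of_true hc, ind_of_true h1]
                rw [ind_of_true]
                · simp
                · rw [← freeRegion_removeNth hi]
                  exact mem_freeRegion_of_isFree hi h2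
              · simp [ind_of_false hi]
            · simp [hC, ind_of_false hc]
      _ = lam * gcSum μ lam (fun n x => C n x * H n x * μ (freeRegion R v x)) := by
          rw [gcSum_palmSum fun n => (((hCm n).mul (hHm n)).comp measurable_fst).mul
            (measurable_ind (measurableSet_freeRegion hR measurable_fst measurable_snd
              measurable_const))]
          congr 1
          refine gcSum_congr fun n x => ?_
          have hT := measurableSet_freeRegion_apply hR v x
          have hTi : Measurable fun y => ind (y ∈ freeRegion R v x) := measurable_ind hT
          rw [lintegral_const_mul _ hTi, lintegral_ind_mem μ hT]
      _ = gcSum μ lam (fun n x => C n x * (lam * μ (freeRegion R v x) * H n x)) := by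
          have h1 : ∀ n, Measurable fun x => C n x * H n x * μ (freeRegion R v x) := fun n =>
            ((hCm n).mul (hHm n)).mul (measurable_measure_freeRegion hR v n)
          rw [← gcSum_const_mul _ h1]
          exact gcSum_congr fun n x => by ring
  have hfin : gcSum μ lam (fun n x => C n x * (lam * μ (freeRegion R v x) * H n x)) ≠ ∞ := by
    refine gcSum_ne_top hlam hlam fun n x => ?_
    calc C n x * (lam * μ (freeRegion R v x) * H n x) ≤ 1 * (lam * 1 * 1) := by
          gcongr
          · exact ind_le_one _
          · exact prob_le_one
          · exact hH1 n x
      _ = lam := by simp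
  refine ENNReal.le_of_add_le_add_right hfin ?_
  rw [← hsum]
  gcongr

/-- The tangent line of `exp (-w)` at `w = t` bounds it below by `exp (-t) * (1 + t - w)`; the
negative part is moved to the other side. -/
theorem gcSum_code_le (hR : MeasurableSet {p : S × S | R p.1 p.2})
    (hsymm : ∀ a b, R a b → R b a) (hlam : lam ≠ ∞) (v : S) (t : ℝ) :
    ENNReal.ofReal (Real.exp (-t) * (1 + t)) * gcSum μ lam (fun _ x => ind (IsCode R x)) ≤
      gcSum μ lam (fun _ x => ind (IsCode R x) * ind (IsFree R x v)) +
        ENNReal.ofReal (Real.exp (-t)) *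
          gcSum μ lam (fun _ x => ind (IsCode R x) * (lam * μ (freeRegion R v x))) := by
  refine le_trans ?_ (add_le_add_left (gcSum_exp_le hR hsymm hlam v) _)
  have hm : ∀ n, Measurable fun x : Fin n → S =>
      ind (IsCode R x) * (lam * μ (freeRegion R v x)) := fun n =>
    (measurable_ind_isCode hR n).mul ((measurable_measure_freeRegion hR v n).const_mul lam)
  have hm' : ∀ n, Measurable fun x : Fin n → S => ind (IsCode R x) *
      ENNReal.ofReal (Real.exp (-(lam * μ (freeRegion R v x)).toReal)) := fun n =>
    (measurable_ind_isCode hR n).mul (Real.measurable_exp.comp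
      ((measurable_measure_freeRegion hR v n).const_mul lam).ennreal_toReal.neg).ennreal_ofReal
  rw [← gcSum_const_mul _ (measurable_ind_isCode hR), ← gcSum_const_mul _ hm, ← gcSum_add hm']
  refine gcSum_mono fun n x => ?_
  have htop : lam * μ (freeRegion R v x) ≠ ∞ := ENNReal.mul_ne_top hlam (measure_ne_top _ _)
  set w := (lam * μ (freeRegion R v x)).toReal with hw
  have h1 : lam * μ (freeRegion R v x) = ENNReal.ofReal w := (ENNReal.ofReal_toReal htop).symm
  have hw0 : 0 ≤ w := ENNReal.toReal_nonneg
  rw [h1, mul_left_comm (ENNReal.ofReal _), ← mul_add, mul_comm]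
  gcongr
  rw [← ENNReal.ofReal_mul (Real.exp_pos _).le, ← ENNReal.ofReal_add (Real.exp_pos _).le
    (mul_nonneg (Real.exp_pos _).le hw0)]
  apply ENNReal.ofReal_le_ofReal
  have h2 : Real.exp (-w) = Real.exp (-t) * Real.exp (t - w) := by
    rw [← Real.exp_add]; ring_nf
  rw [h2, ← mul_add]
  refine mul_le_mul_of_nonneg_left ?_ (Real.exp_pos _).le
  linarith [Real.add_one_le_exp (t - w)]

/-- A point of `T` is either free of the whole configuration or in conflict with a point that lies
in the conflict region of `v`. By Mecke the free part accounts for the number of conflicts, and the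
blocked part is at most `lam * ∫ z in T, μ (T ∩ {y | R z y})`, hence at most `lam * b * μ T`. -/
theorem gcSum_freeRegion_le (hR : MeasurableSet {p : S × S | R p.1 p.2})
    (hsymm : ∀ a b, R a b → R b a) {b : ℝ≥0∞} (v : S)
    (hb : ∀ T : Set S, MeasurableSet T → (∀ y ∈ T, R v y) →
      ∫⁻ z in T, μ (T ∩ {y | R z y}) ∂μ ≤ b * μ T) :
    gcSum μ lam (fun _ x => ind (IsCode R x) * (lam * μ (freeRegion R v x))) ≤
      gcSum μ lam (fun _ x => ind (IsCode R x) * conflicts R v x) + lam * b *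
        gcSum μ lam (fun _ x => ind (IsCode R x) * (lam * μ (freeRegion R v x))) := by
  have hCm := measurable_ind_isCode hR
  have hTm : ∀ n (x : Fin n → S), MeasurableSet (freeRegion R v x) := fun n x =>
    measurableSet_freeRegion_apply hR v x
  have hμm : ∀ n, Measurable fun x : Fin n → S => ind (IsCode R x) * μ (freeRegion R v x) :=
    fun n => (hCm n).mul (measurable_measure_freeRegion hR v n)
  have h0 : gcSum μ lam (fun _ x => ind (IsCode R x) * (lam * μ (freeRegion R v x))) =
      lam * gcSum μ lam (fun _ x => ind (IsCode R x) * μ (freeRegion R v x)) := by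
    rw [← gcSum_const_mul _ hμm]
    exact gcSum_congr fun n x => by ring
  have hFm : ∀ n, Measurable fun p : (Fin n → S) × S =>
      ind (IsCode R p.1) * ind (R v p.2 ∧ IsFree R p.1 p.2) := fun n =>
    ((hCm n).comp measurable_fst).mul (measurable_ind
      ((measurableSet_rel hR measurable_const measurable_snd).inter
        (measurableSet_isFree hR measurable_fst measurable_snd)))
  have h1 : gcSum μ lam (fun _ x => ind (IsCode R x) * conflicts R v x) =
      lam * gcSum μ lam (fun _ x =>
        ∫⁻ y, ind (IsCode R x) * ind (R v y ∧ IsFree R x y) ∂μ) := by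
    rw [← gcSum_palmSum hFm]
    refine gcSum_congr fun n x => ?_
    cases n with
    | zero => simp [palmSum, conflicts]
    | succ n =>
      rw [natCast_conflicts, Finset.mul_sum, palmSum]
      refine Finset.sum_congr rfl fun i _ => ?_
      rw [← ind_and, ← ind_and, isCode_iff_removeNth hsymm x i]
      congr 1
      simp only [eq_iff_iff]
      tauto
  set P : ∀ n, (Fin n → S) → ℝ≥0∞ := fun n x =>
    ind (IsCode R x) * ∑ i, ind (R v (x i)) * μ (freeRegion R v x ∩ {y | R (x i) y}) with hP
  have hconf : ∀ n, Measurable fun p : (Fin n → S) × S =>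
      μ (freeRegion R v p.1 ∩ {y | R p.2 y}) := fun n =>
    measurable_measure_prodMk_left (ν := μ)
      (s := {q : ((Fin n → S) × S) × S | q.2 ∈ freeRegion R v q.1.1 ∩ {y | R q.1.2 y}})
      ((measurableSet_freeRegion hR (measurable_fst.comp measurable_fst) measurable_snd
        measurable_const).inter
        (measurableSet_rel hR (measurable_snd.comp measurable_fst) measurable_snd))
  -- Union bound over the points that block parts of `T`; membership in `T` forces every blocker to
  -- be in conflict with `v`.
  have h2 : gcSum μ lam (fun _ x => ind (IsCode R x) * μ (freeRegion R v x)) ≤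
      gcSum μ lam (fun _ x => ∫⁻ y, ind (IsCode R x) * ind (R v y ∧ IsFree R x y) ∂μ) +
        gcSum μ lam P := by
    have hFm' : ∀ n, Measurable fun x : Fin n → S =>
        ∫⁻ y, ind (IsCode R x) * ind (R v y ∧ IsFree R x y) ∂μ := fun n =>
      (hFm n).lintegral_prod_right'
    rw [← gcSum_add hFm']
    refine gcSum_mono fun n x => ?_
    have hm1 : Measurable fun y => ind (R v y ∧ IsFree R x y) := measurable_ind
      ((measurableSet_rel hR measurable_const measurable_id).inter
        (measurableSet_isFree hR measurable_const measurable_id))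
    have hm2 : ∀ i, MeasurableSet (freeRegion R v x ∩ {y | R (x i) y}) := fun i =>
      (hTm n x).inter (measurableSet_rel hR measurable_const measurable_id)
    rw [lintegral_const_mul _ hm1, hP, ← mul_add]
    gcongr
    rw [← lintegral_ind_mem μ (hTm n x)]
    have h3 : ∑ i, ind (R v (x i)) * μ (freeRegion R v x ∩ {y | R (x i) y}) =
        ∫⁻ y, ∑ i, ind (R v (x i)) * ind (y ∈ freeRegion R v x ∩ {y | R (x i) y}) ∂μ := by
      have hm3 : ∀ i, Measurable fun y => ind (y ∈ freeRegion R v x ∩ {y | R (x i) y}) :=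
        fun i => measurable_ind (hm2 i)
      rw [lintegral_finsetSum _ fun i _ => (hm3 i).const_mul _]
      refine Finset.sum_congr rfl fun i _ => ?_
      rw [lintegral_const_mul _ (hm3 i), lintegral_ind_mem μ (hm2 i)]
    rw [h3, ← lintegral_add_left hm1]
    refine lintegral_mono fun y => ?_
    by_cases hy : y ∈ freeRegion R v x
    · by_cases hf : IsFree R x y
      · rw [ind_of_true (p := R v y ∧ _) ⟨hy.1, hf⟩]
        exact le_add_right (ind_le_one _)
      · obtain ⟨i, hi⟩ := not_forall_not.1 hf
        have hvi : R v (x i) := by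
          by_contra h
          exact hy.2 i h hi
        refine le_add_left (le_trans (ind_le_one _) ?_)
        refine le_trans ?_ (Finset.single_le_sum (fun _ _ => zero_le) (Finset.mem_univ i))
        rw [ind_of_true hvi, ind_of_true ⟨hy, hsymm _ _ hi⟩, one_mul]
    · simp [ind_of_false hy]
  have h3 : gcSum μ lam P ≤
      lam * b * gcSum μ lam (fun _ x => ind (IsCode R x) * μ (freeRegion R v x)) := by
    calc gcSum μ lam P
        ≤ gcSum μ lam (palmSum fun n x z => ind (IsCode R x) *
            (ind (z ∈ freeRegion R v x) * μ (freeRegion R v x ∩ {y | R z y}))) := by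
          refine gcSum_mono fun n x => ?_
          cases n with
          | zero => simp [hP]
          | succ n =>
            simp only [hP, palmSum, Finset.mul_sum]
            refine Finset.sum_le_sum fun i _ => ?_
            by_cases hc : IsCode R x
            · by_cases hi : R v (x i)
              · obtain ⟨h1, h2⟩ := (isCode_iff_removeNth hsymm x i).1 hc
                have h4 : x i ∈ freeRegion R v x := by
                  rw [← freeRegion_removeNth hi]
                  exact mem_freeRegion_of_isFree hi h2
                rw [freeRegion_removeNth hi, ind_of_true hi, ind_of_true hc, ind_of_true h1,
                  ind_of_true h4]
              · simp [ind_of_false hi]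
            · simp [ind_of_false hc]
      _ = lam * gcSum μ lam (fun n x => ∫⁻ z, ind (IsCode R x) *
            (ind (z ∈ freeRegion R v x) * μ (freeRegion R v x ∩ {y | R z y})) ∂μ) :=
          gcSum_palmSum fun n => ((hCm n).comp measurable_fst).mul
            ((measurable_ind (measurableSet_freeRegion hR measurable_fst measurable_snd
              measurable_const)).mul (hconf n))
      _ ≤ lam * gcSum μ lam (fun n x => b * (ind (IsCode R x) * μ (freeRegion R v x))) := by
          gcongr
          refine gcSum_mono fun n x => ?_
          have hcx : Measurable fun z => μ (freeRegion R v x ∩ {y | R z y}) :=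
            (hconf n).comp measurable_prodMk_left
          have hTi : Measurable fun z =>
              ind (z ∈ freeRegion R v x) * μ (freeRegion R v x ∩ {y | R z y}) :=
            (measurable_ind (hTm n x)).mul hcx
          rw [lintegral_const_mul _ hTi, mul_left_comm]
          gcongr
          refine le_trans (le_of_eq ?_) (hb _ (hTm n x) fun y hy => hy.1)
          rw [← lintegral_indicator (hTm n x)]
          congr with z
          by_cases hz : z ∈ freeRegion R v x
          · rw [ind_of_true hz, Set.indicator_of_mem hz, one_mul]
          · rw [ind_of_false hz, Set.indicator_of_notMem hz, zero_mul]
      _ = _ := by rw [gcSum_const_mul _ hμm, mul_assoc]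
  rw [h0, h1]
  calc _ ≤ lam * (gcSum μ lam (fun _ x =>
          ∫⁻ y, ind (IsCode R x) * ind (R v y ∧ IsFree R x y) ∂μ) + lam * b *
            gcSum μ lam (fun _ x => ind (IsCode R x) * μ (freeRegion R v x))) := by
        gcongr
        exact h2.trans (by gcongr)
    _ = _ := by ring

theorem gcSum_freeRegion_le_of_lt (hR : MeasurableSet {p : S × S | R p.1 p.2})
    (hsymm : ∀ a b, R a b → R b a) (hlam : lam ≠ ∞) {b : ℝ≥0∞} (v : S)
    (hb : ∀ T : Set S, MeasurableSet T → (∀ y ∈ T, R v y) →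
      ∫⁻ z in T, μ (T ∩ {y | R z y}) ∂μ ≤ b * μ T)
    {κ : ℝ} (hκ0 : 0 < κ) (hκ1 : κ ≤ 1) (hκ : lam * b ≤ ENNReal.ofReal (1 - κ)) :
    gcSum μ lam (fun _ x => ind (IsCode R x) * (lam * μ (freeRegion R v x))) ≤
      ENNReal.ofReal κ⁻¹ * gcSum μ lam (fun _ x => ind (IsCode R x) * conflicts R v x) := by
  have h := gcSum_freeRegion_le hR hsymm (lam := lam) v hb
  have hfin : gcSum μ lam (fun _ x => ind (IsCode R x) * (lam * μ (freeRegion R v x))) ≠ ∞ := by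
    refine gcSum_ne_top hlam hlam fun n x => ?_
    calc ind (IsCode R x) * (lam * μ (freeRegion R v x)) ≤ 1 * (lam * 1) := by
          gcongr
          · exact ind_le_one _
          · exact prob_le_one
      _ = lam := by simp
  set B := gcSum μ lam (fun _ x => ind (IsCode R x) * (lam * μ (freeRegion R v x))) with hB
  set N := gcSum μ lam (fun _ x => ind (IsCode R x) * conflicts R v x)
  -- Split `B` so that the overlap term can be absorbed by cancelling `(1 - κ) * B`, which is
  -- finite.
  have h1 : ENNReal.ofReal κ * B + ENNReal.ofReal (1 - κ) * B = B := by
    rw [← add_mul, ← ENNReal.ofReal_add hκ0.le (by linarith)]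
    simp
  have h2 : ENNReal.ofReal κ * B ≤ N := by
    refine ENNReal.le_of_add_le_add_right (ENNReal.mul_ne_top ENNReal.ofReal_ne_top hfin)
      (a := ENNReal.ofReal (1 - κ) * B) ?_
    rw [h1]
    exact h.trans (by gcongr)
  calc B = ENNReal.ofReal κ⁻¹ * (ENNReal.ofReal κ * B) := by
        rw [← mul_assoc, ← ENNReal.ofReal_mul (by positivity), inv_mul_cancel₀ hκ0.ne']
        simp
    _ ≤ _ := by gcongr

/-- A lower bound for the mean number of points in a grand canonical hard core model in terms of
the measure `s` of the conflict region of a point and of a bound `b` for the mean measure of the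
conflict region of a point within a set of points in conflict with a given one. -/
theorem gcSum_code_le_gcSum_size (hR : MeasurableSet {p : S × S | R p.1 p.2})
    (hsymm : ∀ a b, R a b → R b a) (hlam : lam ≠ ∞) {b s : ℝ≥0∞}
    (hs : ∀ y, μ {v | R v y} ≤ s)
    (hb : ∀ v, ∀ T : Set S, MeasurableSet T → (∀ y ∈ T, R v y) →
      ∫⁻ z in T, μ (T ∩ {y | R z y}) ∂μ ≤ b * μ T)
    {κ : ℝ} (hκ0 : 0 < κ) (hκ1 : κ ≤ 1) (hκ : lam * b ≤ ENNReal.ofReal (1 - κ)) (t : ℝ) :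
    ENNReal.ofReal (Real.exp (-t) * (1 + t)) *
        (lam * gcSum μ lam (fun _ x => ind (IsCode R x))) ≤
      gcSum μ lam (fun n x => ind (IsCode R x) * n) +
        ENNReal.ofReal (Real.exp (-t)) * ENNReal.ofReal κ⁻¹ * lam * s *
          gcSum μ lam (fun n x => ind (IsCode R x) * n) := by
  have hCm := measurable_ind_isCode hR
  have hFm : ∀ n, Measurable fun p : (Fin n → S) × S =>
      ind (IsCode R p.1) * ind (IsFree R p.1 p.2) := fun n =>
    ((hCm n).comp measurable_fst).mul
      (measurable_ind (measurableSet_isFree hR measurable_fst measurable_snd))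
  have hFm' : ∀ n, Measurable fun p : S × (Fin n → S) =>
      ind (IsCode R p.2) * ind (IsFree R p.2 p.1) := fun n => (hFm n).comp measurable_swap
  have hNm : ∀ n, Measurable fun p : S × (Fin n → S) =>
      ind (IsCode R p.2) * (conflicts R p.1 p.2 : ℝ≥0∞) := fun n =>
    ((hCm n).comp measurable_snd).mul
      ((Measurable.of_discrete (f := fun k : ℕ => (k : ℝ≥0∞))).comp
        (measurable_conflicts hR measurable_snd measurable_fst))
  -- Mecke read backwards: a free point added to a code gives a code with one marked point.
  have hfree : lam * ∫⁻ v, gcSum μ lam (fun _ x => ind (IsCode R x) * ind (IsFree R x v)) ∂μ =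
      gcSum μ lam (fun n x => ind (IsCode R x) * n) := by
    rw [lintegral_gcSum (f := fun v _ x => ind (IsCode R x) * ind (IsFree R x v)) hFm',
      ← gcSum_palmSum hFm]
    refine gcSum_congr fun n x => ?_
    cases n with
    | zero => simp [palmSum]
    | succ n =>
      have h : ∀ i, ind (IsCode R (i.removeNth x)) * ind (IsFree R (i.removeNth x) (x i)) =
          ind (IsCode R x) := fun i => by rw [← ind_and, isCode_iff_removeNth hsymm x i]
      simp only [palmSum, h, Finset.sum_const, Finset.card_univ, Fintype.card_fin, nsmul_eq_mul]
      rw [mul_comm]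
  have hconf : ∫⁻ v, gcSum μ lam (fun _ x => ind (IsCode R x) * conflicts R v x) ∂μ ≤
      s * gcSum μ lam (fun n x => ind (IsCode R x) * n) := by
    rw [lintegral_gcSum (f := fun v _ x => ind (IsCode R x) * conflicts R v x) hNm,
      ← gcSum_const_mul _ fun n => (hCm n).mul_const _]
    refine gcSum_mono fun n x => ?_
    have hm : ∀ i, MeasurableSet {v | R v (x i)} := fun i =>
      measurableSet_rel hR measurable_id measurable_const
    have hsum : Measurable fun v => ∑ i, ind (R v (x i)) :=
      Finset.measurable_sum _ fun i _ => measurable_ind (hm i)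
    simp only [natCast_conflicts]
    rw [lintegral_const_mul _ hsum, mul_left_comm]
    gcongr
    rw [lintegral_finsetSum _ fun i _ => measurable_ind (hm i)]
    calc ∑ i, ∫⁻ v, ind (R v (x i)) ∂μ ≤ ∑ _i : Fin n, s := by
          refine Finset.sum_le_sum fun i _ => ?_
          rw [lintegral_ind μ (hm i)]
          exact hs _
      _ = s * n := by simp [mul_comm]
  have hpt : ∀ v, ENNReal.ofReal (Real.exp (-t) * (1 + t)) *
        gcSum μ lam (fun _ x => ind (IsCode R x)) ≤
      gcSum μ lam (fun _ x => ind (IsCode R x) * ind (IsFree R x v)) +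
        ENNReal.ofReal (Real.exp (-t)) * (ENNReal.ofReal κ⁻¹ *
          gcSum μ lam (fun _ x => ind (IsCode R x) * conflicts R v x)) := fun v => by
    refine (gcSum_code_le hR hsymm hlam v t).trans ?_
    gcongr
    exact gcSum_freeRegion_le_of_lt hR hsymm hlam v (hb v) hκ0 hκ1 hκ
  have hF : Measurable fun v => gcSum μ lam (fun _ x => ind (IsCode R x) * ind (IsFree R x v)) :=
    Measurable.tsum fun n => ((hFm' n).lintegral_prod_right').const_mul _
  have hN : Measurable fun v => gcSum μ lam (fun _ x => ind (IsCode R x) * conflicts R v x) :=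
    Measurable.tsum fun n => ((hNm n).lintegral_prod_right').const_mul _
  have hint := lintegral_mono (μ := μ) hpt
  rw [lintegral_const, measure_univ, mul_one, lintegral_add_left hF,
    lintegral_const_mul _ (hN.const_mul _), lintegral_const_mul _ hN] at hint
  calc _ = lam * (ENNReal.ofReal (Real.exp (-t) * (1 + t)) *
        gcSum μ lam (fun _ x => ind (IsCode R x))) := mul_left_comm _ _ _
    _ ≤ _ := mul_le_mul_right hint lam
    _ ≤ gcSum μ lam (fun n x => ind (IsCode R x) * n) +
        lam * (ENNReal.ofReal (Real.exp (-t)) * (ENNReal.ofReal κ⁻¹ *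
          (s * gcSum μ lam (fun n x => ind (IsCode R x) * n)))) := by
        rw [mul_add, hfree]
        gcongr
    _ = _ := by ring

end GrandCanonical

/-! ### Mean overlap by ordering conflicting pairs -/

section Lens

variable {S : Type*} [MeasurableSpace S] {μ : Measure S} [IsProbabilityMeasure μ]
  {R : S → S → Prop}

/-- To bound the mean measure of the conflict region of a point of `T` within `T`, it is enough to
consider, for each point, those points of `T` that are not below it for a given function. -/
theorem lintegral_measure_inter_le (hR : MeasurableSet {p : S × S | R p.1 p.2})
    (hsymm : ∀ a b, R a b → R b a) {ρ : S → ℝ} (hρ : Measurable ρ) {T : Set S} {b : ℝ≥0∞}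
    (h : ∀ y ∈ T, μ {z | R y z ∧ ρ y ≤ ρ z} ≤ b) :
    ∫⁻ z in T, μ (T ∩ {y | R z y}) ∂μ ≤ 2 * b * μ T := by
  set ν := μ.restrict T with hν
  have hm : Measurable fun p : S × S => ind (R p.1 p.2 ∧ ρ p.1 ≤ ρ p.2) :=
    measurable_ind (hR.inter (measurableSet_le (hρ.comp measurable_fst) (hρ.comp measurable_snd)))
  -- In each conflicting pair at least one point is not below the other; the two orderings have
  -- equal double integrals, whence the factor 2.
  have h1 : ∀ z, μ (T ∩ {y | R z y}) ≤
      ∫⁻ y, ind (R z y ∧ ρ z ≤ ρ y) ∂ν + ∫⁻ y, ind (R y z ∧ ρ y ≤ ρ z) ∂ν := by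
    intro z
    have hz : MeasurableSet {y | R z y} := measurableSet_rel hR measurable_const measurable_id
    have hmz : Measurable fun y => ind (R z y ∧ ρ z ≤ ρ y) := hm.comp measurable_prodMk_left
    rw [Set.inter_comm, ← Measure.restrict_apply hz, ← lintegral_ind ν hz,
      ← lintegral_add_left hmz]
    refine lintegral_mono fun y => ?_
    by_cases hzy : R z y
    · rcases le_total (ρ z) (ρ y) with hle | hle
      · rw [ind_of_true (p := R z y ∧ _) ⟨hzy, hle⟩]
        exact le_add_right (ind_le_one _)
      · rw [ind_of_true (p := R y z ∧ _) ⟨hsymm _ _ hzy, hle⟩]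
        exact le_add_left (ind_le_one _)
    · simp [ind_of_false hzy]
  have h2 : ∫⁻ z, ∫⁻ y, ind (R z y ∧ ρ z ≤ ρ y) ∂ν ∂ν ≤ b * μ T := by
    calc ∫⁻ z, ∫⁻ y, ind (R z y ∧ ρ z ≤ ρ y) ∂ν ∂ν ≤ ∫⁻ _ in T, b ∂μ := by
          refine setLIntegral_mono measurable_const fun z hz => ?_
          have hmz : MeasurableSet {y | R z y ∧ ρ z ≤ ρ y} :=
            (measurableSet_rel hR measurable_const measurable_id).inter
              (measurableSet_le measurable_const hρ)
          rw [lintegral_ind ν hmz]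
          exact (Measure.restrict_apply_le _ _).trans (h z hz)
      _ = b * μ T := by rw [setLIntegral_const]
  have h3 : ∫⁻ z, ∫⁻ y, ind (R y z ∧ ρ y ≤ ρ z) ∂ν ∂ν =
      ∫⁻ z, ∫⁻ y, ind (R z y ∧ ρ z ≤ ρ y) ∂ν ∂ν :=
    lintegral_lintegral_swap (f := fun z y => ind (R y z ∧ ρ y ≤ ρ z))
      (hm.comp measurable_swap).aemeasurable
  calc ∫⁻ z, μ (T ∩ {y | R z y}) ∂ν
      ≤ ∫⁻ z, (∫⁻ y, ind (R z y ∧ ρ z ≤ ρ y) ∂ν + ∫⁻ y, ind (R y z ∧ ρ y ≤ ρ z) ∂ν) ∂ν :=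
        lintegral_mono h1
    _ = ∫⁻ z, ∫⁻ y, ind (R z y ∧ ρ z ≤ ρ y) ∂ν ∂ν +
        ∫⁻ z, ∫⁻ y, ind (R y z ∧ ρ y ≤ ρ z) ∂ν ∂ν :=
        lintegral_add_left hm.lintegral_prod_right' _
    _ ≤ b * μ T + b * μ T := by rw [h3]; gcongr
    _ = 2 * b * μ T := by ring

end Lens

/-! ### Trigonometry of `q θ` -/

section Angles

variable {θ : ℝ}

theorem cos_mem_Ioo (hθ : θ ∈ Set.Ioo 0 (Real.pi / 2)) : Real.cos θ ∈ Set.Ioo (0 : ℝ) 1 := by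
  refine ⟨Real.cos_pos_of_mem_Ioo ⟨by linarith [hθ.1, Real.pi_pos], hθ.2⟩, ?_⟩
  rw [← Real.cos_zero]
  exact Real.cos_lt_cos_of_nonneg_of_le_pi le_rfl (by linarith [hθ.2, Real.pi_pos]) hθ.1

theorem sin_pos_of_mem (hθ : θ ∈ Set.Ioo 0 (Real.pi / 2)) : 0 < Real.sin θ :=
  Real.sin_pos_of_pos_of_lt_pi hθ.1 (by linarith [hθ.2, Real.pi_pos])

theorem sqrt_div_sin_sq (hθ : θ ∈ Set.Ioo 0 (Real.pi / 2)) :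
    (√((Real.cos θ - 1) ^ 2 * (1 + 2 * Real.cos θ)) / Real.sin θ) ^ 2 =
      1 - 2 * Real.cos θ ^ 2 / (1 + Real.cos θ) := by
  obtain ⟨hc0, hc1⟩ := cos_mem_Ioo hθ
  have h1 : Real.sin θ ^ 2 = (1 - Real.cos θ) * (1 + Real.cos θ) := by
    rw [Real.sin_sq]; ring
  have h2 : 1 - Real.cos θ ≠ 0 := by linarith
  have h3 : 1 + Real.cos θ ≠ 0 := by linarith
  rw [div_pow, Real.sq_sqrt (by positivity), h1]
  field_simp
  ring

theorem sqrt_div_sin_pos (hθ : θ ∈ Set.Ioo 0 (Real.pi / 2)) :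
    0 < √((Real.cos θ - 1) ^ 2 * (1 + 2 * Real.cos θ)) / Real.sin θ := by
  obtain ⟨hc0, hc1⟩ := cos_mem_Ioo hθ
  have h2 : Real.cos θ - 1 ≠ 0 := by linarith
  have := sin_pos_of_mem hθ
  positivity

theorem sqrt_div_sin_lt_one (hθ : θ ∈ Set.Ioo 0 (Real.pi / 2)) :
    √((Real.cos θ - 1) ^ 2 * (1 + 2 * Real.cos θ)) / Real.sin θ < 1 := by
  obtain ⟨hc0, hc1⟩ := cos_mem_Ioo hθ
  rw [← sq_lt_one_iff₀ (sqrt_div_sin_pos hθ).le, sqrt_div_sin_sq hθ]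
  have : 0 < 2 * Real.cos θ ^ 2 / (1 + Real.cos θ) := by positivity
  linarith

theorem sin_q (hθ : θ ∈ Set.Ioo 0 (Real.pi / 2)) :
    Real.sin (q θ) = √((Real.cos θ - 1) ^ 2 * (1 + 2 * Real.cos θ)) / Real.sin θ :=
  Real.sin_arcsin (by linarith [sqrt_div_sin_pos hθ]) (sqrt_div_sin_lt_one hθ).le

theorem q_mem_Ioo (hθ : θ ∈ Set.Ioo 0 (Real.pi / 2)) : q θ ∈ Set.Ioo 0 (Real.pi / 2) :=
  ⟨Real.arcsin_pos.2 (sqrt_div_sin_pos hθ), Real.arcsin_lt_pi_div_two.2 (sqrt_div_sin_lt_one hθ)⟩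

/-- The form in which `q` meets the lens: the value is `(2 cos θ) ^ 2 / (2 + 2 cos θ)`, where the
denominator is the squared norm of the sum of two unit vectors at angle `θ`. -/
theorem cos_q_sq (hθ : θ ∈ Set.Ioo 0 (Real.pi / 2)) :
    Real.cos (q θ) ^ 2 = 2 * Real.cos θ ^ 2 / (1 + Real.cos θ) := by
  rw [Real.cos_sq', sin_q hθ, sqrt_div_sin_sq hθ]
  ring

theorem sin_q_lt_sin (hθ : θ ∈ Set.Ioo 0 (Real.pi / 2)) : Real.sin (q θ) < Real.sin θ := by
  obtain ⟨hc0, hc1⟩ := cos_mem_Ioo hθ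
  refine lt_of_pow_lt_pow_left₀ 2 (sin_pos_of_mem hθ).le ?_
  rw [sin_q hθ, sqrt_div_sin_sq hθ, Real.sin_sq]
  have : Real.cos θ ^ 2 < 2 * Real.cos θ ^ 2 / (1 + Real.cos θ) := by
    rw [lt_div_iff₀ (by linarith)]
    nlinarith [pow_pos hc0 2]
  linarith

theorem c_pos (hθ : θ ∈ Set.Ioo 0 (Real.pi / 2)) : 0 < c θ :=
  Real.log_pos ((one_lt_div (sin_pos_of_mem (q_mem_Ioo hθ))).2 (sin_q_lt_sin hθ))

end Angles

/-! ### Lenses and cap areas -/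

section Caps

open scoped Pointwise

variable {d : ℕ}

local notation "E" => EuclideanSpace ℝ (Fin d)

theorem measurableSet_cap (θ : ℝ) (x : Sph d) : MeasurableSet (cap θ x) :=
  measurableSet_le measurable_const
    ((continuous_const.inner continuous_subtype_val).measurable)

/-- The intersection of two caps of angular radius `θ` and of angular radius the distance of their
centres, at most `θ`, lies in a cap of angular radius `q θ`. -/
theorem exists_lens_subset_cap {θ : ℝ} (hθ : θ ∈ Set.Ioo 0 (Real.pi / 2)) (v y : Sph d)
    (hvy : Real.cos θ ≤ inner ℝ (v : E) (y : E)) :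
    ∃ m : Sph d, {z : Sph d | Real.cos θ < inner ℝ (y : E) (z : E) ∧
      inner ℝ (v : E) (y : E) ≤ inner ℝ (v : E) (z : E)} ⊆ cap (q θ) m := by
  obtain ⟨hc0, hc1⟩ := cos_mem_Ioo hθ
  set a := inner ℝ (v : E) (y : E) with ha
  set c := Real.cos θ with hc
  have hn : ‖(v : E) + y‖ ^ 2 = 2 + 2 * a := by
    rw [norm_add_sq_real]
    simp only [norm_eq_of_mem_sphere]
    ring
  have hpos : 0 < ‖(v : E) + y‖ := by
    rcases (norm_nonneg ((v : E) + y)).eq_or_lt with h | h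
    · rw [← h] at hn; linarith
    · exact h
  -- The centre is the midpoint of `v` and `y`. The inner product of `z` with `v + y` is at least `a
  -- + c`, and `(a + c) ^ 2 / (2 + 2 * a)` for `a ≥ c` is least at `a = c`, where it equals `cos (q
  -- θ) ^ 2`.
  refine ⟨⟨‖(v : E) + y‖⁻¹ • ((v : E) + y), ?_⟩, ?_⟩
  · rw [mem_sphere_zero_iff_norm, norm_smul, norm_inv, norm_norm, inv_mul_cancel₀ hpos.ne']
  · rintro z ⟨hz1, hz2⟩
    change Real.cos (q θ) ≤ inner ℝ (‖(v : E) + y‖⁻¹ • ((v : E) + y)) (z : E)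
    rw [real_inner_smul_left, inner_add_left, inv_mul_eq_div, le_div_iff₀ hpos]
    refine le_trans ?_ (show a + c ≤ _ by linarith)
    refine le_of_sq_le_sq ?_ (by linarith)
    rw [mul_pow, hn, cos_q_sq hθ, ← hc, div_mul_eq_mul_div, div_le_iff₀ (by linarith)]
    nlinarith [mul_nonneg hc0.le (sub_nonneg.2 hvy), sq_nonneg (a - c),
      mul_nonneg hc0.le (sq_nonneg (a - c))]

/-- A point of a thin slab of the ball of radius `s` around `(c + δ * s) • x`, where
`s ^ 2 + c ^ 2 = 1`, is at angle at most `arccos c` to `x` and has norm little more than one. -/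
theorem slab_subset_cone {F : Type*} [NormedAddCommGroup F] [InnerProductSpace ℝ F] {x w : F}
    {c s δ a : ℝ} (hx : ‖x‖ = 1) (hc : 0 < c) (hs : 0 < s) (hsc : s ^ 2 + c ^ 2 = 1)
    (hδ : 0 < δ) (ha : a = c + δ * s) (hw : ‖w‖ ≤ s) (h1 : inner ℝ x w < δ * s)
    (h2 : -inner ℝ x w < δ * s) :
    0 < ‖a • x + w‖ ∧ ‖a • x + w‖ < 1 + 7 * δ ∧ c * ‖a • x + w‖ ≤ inner ℝ x (a • x + w) := by
  have hz2 : ‖w‖ ^ 2 ≤ s ^ 2 := pow_le_pow_left₀ (norm_nonneg _) hw 2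
  have hin : inner ℝ x (a • x + w) = a + inner ℝ x w := by
    rw [inner_add_right, inner_smul_right, real_inner_self_eq_norm_sq, hx]
    ring
  have hnorm : ‖a • x + w‖ ^ 2 = a ^ 2 + 2 * a * inner ℝ x w + ‖w‖ ^ 2 := by
    rw [norm_add_sq_real, norm_smul, hx, real_inner_smul_left, Real.norm_eq_abs, mul_one, sq_abs]
    ring
  have hwh : inner ℝ x w ^ 2 ≤ ‖w‖ ^ 2 := by
    have h := abs_real_inner_le_norm x w
    rw [hx, one_mul] at h
    have h' := pow_le_pow_left₀ (abs_nonneg _) h 2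
    rwa [sq_abs] at h'
  obtain ⟨h, hh⟩ : ∃ h, h = inner ℝ x w := ⟨_, rfl⟩
  rw [← hh] at h1 h2 hin hnorm hwh
  have hah : c ≤ a + h := by linarith
  have hc1 : c ≤ 1 := by nlinarith [sq_nonneg s]
  have hs1 : s ≤ 1 := by nlinarith [sq_nonneg c]
  obtain ⟨u, hu⟩ : ∃ u, u = δ * s := ⟨_, rfl⟩
  rw [← hu] at ha h1 h2
  have hu0 : 0 < u := hu ▸ mul_pos hδ hs
  have huδ : u ≤ δ := hu ▸ mul_le_of_le_one_right hδ.le hs1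
  have ha0 : 0 < a := by linarith
  refine ⟨?_, ?_, ?_⟩
  · refine norm_pos_iff.2 fun h0 => ?_
    rw [h0, inner_zero_right] at hin
    linarith
  -- The squared norm is at most `1 + 4 * δ + 3 * δ ^ 2`, so the constant 7 is generous.
  · refine lt_of_pow_lt_pow_left₀ 2 (by linarith) ?_
    have e1 : a * h ≤ a * u := mul_le_mul_of_nonneg_left h1.le ha0.le
    have e2 : c * u ≤ 1 * δ := mul_le_mul hc1 huδ hu0.le zero_le_one
    have e3 : u ^ 2 ≤ δ ^ 2 := pow_le_pow_left₀ hu0.le huδ 2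
    have e4 : a ^ 2 + 2 * (a * u) = c ^ 2 + 4 * (c * u) + 3 * u ^ 2 := by rw [ha]; ring
    rw [hnorm]
    linarith [sq_nonneg δ]
  -- The part of `w` orthogonal to `x` has length at most `s`, while the component of the point
  -- along `x` is at least `c`; since `s / c` is the tangent of the cone angle, the point is in the
  -- cone.
  · rw [hin]
    refine le_of_sq_le_sq ?_ (by linarith)
    have hcs : c ^ 2 ≤ (a + h) ^ 2 := pow_le_pow_left₀ hc.le hah 2
    have e1 : c ^ 2 * (‖w‖ ^ 2 - h ^ 2) ≤ c ^ 2 * s ^ 2 :=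
      mul_le_mul_of_nonneg_left (by linarith [sq_nonneg h]) (sq_nonneg c)
    have e2 : c ^ 2 * s ^ 2 ≤ (a + h) ^ 2 * s ^ 2 := mul_le_mul_of_nonneg_right hcs (sq_nonneg s)
    have e3 : (a + h) ^ 2 * s ^ 2 + c ^ 2 * (a + h) ^ 2 = (a + h) ^ 2 := by
      rw [mul_comm (c ^ 2), ← mul_add, hsc, mul_one]
    rw [mul_pow, hnorm]
    linarith

/-- The truncated cone of the vectors of norm less than `r` at angle at most `φ` to `x`. -/
def truncatedCone (φ : ℝ) (x : Sph d) (r : ℝ) : Set E :=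
  {z | 0 < ‖z‖ ∧ ‖z‖ < r ∧ Real.cos φ * ‖z‖ ≤ inner ℝ (x : E) z}

theorem truncatedCone_subset_ball (φ : ℝ) (x : Sph d) (r : ℝ) :
    truncatedCone φ x r ⊆ Metric.ball 0 r := fun _ hz => mem_ball_zero_iff.2 hz.2.1

theorem volume_truncatedCone_ne_top (φ : ℝ) (x : Sph d) (r : ℝ) :
    volume (truncatedCone φ x r) ≠ ∞ :=
  measure_ne_top_of_subset (truncatedCone_subset_ball φ x r) measure_ball_lt_top.ne

theorem volume_real_truncatedCone (φ : ℝ) (x : Sph d) {r : ℝ} (hr : 0 < r) :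
    volume.real (truncatedCone φ x r) = r ^ d * volume.real (truncatedCone φ x 1) := by
  have h : truncatedCone φ x r = r • truncatedCone φ x 1 := by
    ext z
    rw [Set.mem_smul_set_iff_inv_smul_mem₀ hr.ne']
    simp only [truncatedCone, Set.mem_ofPred_eq, norm_smul, norm_inv, Real.norm_eq_abs,
      abs_of_pos hr, inner_smul_right]
    have h1 : 0 < r⁻¹ * ‖z‖ ↔ 0 < ‖z‖ := mul_pos_iff_of_pos_left (inv_pos.2 hr)
    have h2 : r⁻¹ * ‖z‖ < 1 ↔ ‖z‖ < r := by rw [inv_mul_lt_iff₀ hr, mul_one]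
    have h3 : Real.cos φ * (r⁻¹ * ‖z‖) ≤ r⁻¹ * inner ℝ (x : E) z ↔
        Real.cos φ * ‖z‖ ≤ inner ℝ (x : E) z := by
      rw [mul_left_comm, mul_le_mul_iff_right₀ (inv_pos.2 hr)]
    rw [h1, h2, h3]
  rw [h, Measure.real, Measure.addHaar_smul, finrank_euclideanSpace_fin, ENNReal.toReal_mul,
    ENNReal.toReal_ofReal (abs_nonneg _), abs_of_pos (pow_pos hr d)]
  rfl

theorem volume_ball_pos : 0 < volume.real (Metric.ball (0 : E) 1) :=
  ENNReal.toReal_pos (Metric.measure_ball_pos _ _ one_pos).ne' measure_ball_lt_top.ne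

/-- `Measure.toSphere` is `d` times the volume of the cone over a set; the factor `d` cancels in the
normalization. Cap areas thus become volumes that can be compared with balls. -/
theorem surf_apply (hd : 0 < d) {A : Set (Sph d)} (hA : MeasurableSet A) :
    surf d A = (volume (Metric.ball (0 : E) 1))⁻¹ *
      volume (Set.Ioo (0 : ℝ) 1 • (((↑) : Sph d → E) '' A)) := by
  rw [surf, Measure.smul_apply, smul_eq_mul, Measure.toSphere_apply' _ hA,
    Measure.toSphere_apply_univ, finrank_euclideanSpace_fin,
    ENNReal.mul_inv (Or.inr measure_ball_lt_top.ne) (Or.inl (ENNReal.natCast_ne_top d)),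
    mul_mul_mul_comm, ENNReal.inv_mul_cancel (by exact_mod_cast hd.ne')
      (ENNReal.natCast_ne_top d), one_mul]

theorem isProbabilityMeasure_surf (hd : 0 < d) : IsProbabilityMeasure (surf d) := by
  constructor
  have h0 : (volume : Measure E).toSphere Set.univ ≠ 0 := by
    rw [Measure.toSphere_apply_univ, finrank_euclideanSpace_fin]
    exact mul_ne_zero (by exact_mod_cast hd.ne') (Metric.measure_ball_pos _ _ one_pos).ne'
  rw [surf, Measure.smul_apply, smul_eq_mul, ENNReal.inv_mul_cancel h0 (measure_ne_top _ _)]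

theorem Ioo_smul_cap (φ : ℝ) (x : Sph d) :
    Set.Ioo (0 : ℝ) 1 • (((↑) : Sph d → E) '' cap φ x) = truncatedCone φ x 1 := by
  ext z
  rw [Set.mem_smul]
  constructor
  · rintro ⟨r, hr, _, ⟨y, hy, rfl⟩, rfl⟩
    have hn : ‖r • (y : E)‖ = r := by
      rw [norm_smul, norm_eq_of_mem_sphere, mul_one, Real.norm_eq_abs, abs_of_pos hr.1]
    refine ⟨hn.symm ▸ hr.1, hn.symm ▸ hr.2, ?_⟩
    change _ * ‖r • (y : E)‖ ≤ inner ℝ (x : E) (r • (y : E))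
    rw [hn, inner_smul_right, mul_comm]
    exact mul_le_mul_of_nonneg_left hy hr.1.le
  · rintro ⟨h0, h1, h2⟩
    refine ⟨‖z‖, ⟨h0, h1⟩, ‖z‖⁻¹ • z, ⟨⟨‖z‖⁻¹ • z, ?_⟩, ?_, rfl⟩, ?_⟩
    · rw [mem_sphere_zero_iff_norm, norm_smul, norm_inv, norm_norm, inv_mul_cancel₀ h0.ne']
    · change Real.cos φ ≤ inner ℝ (x : E) (‖z‖⁻¹ • z)
      rwa [inner_smul_right, inv_mul_eq_div, le_div_iff₀ h0]
    · rw [smul_smul, mul_inv_cancel₀ h0.ne', one_smul]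

theorem capArea_mul_volume_ball (hd : 0 < d) (φ : ℝ) (x : Sph d) :
    capArea d φ * volume.real (Metric.ball (0 : E) 1) = volume.real (truncatedCone φ x 1) := by
  rw [capArea_eq φ x, Measure.real, surf_apply hd (measurableSet_cap φ x), Ioo_smul_cap,
    ENNReal.toReal_mul, ENNReal.toReal_inv, mul_comm, ← mul_assoc]
  change volume.real (Metric.ball (0 : E) 1) * (volume.real (Metric.ball (0 : E) 1))⁻¹ * _ = _
  rw [mul_inv_cancel₀ volume_ball_pos.ne', one_mul]
  rfl

theorem capArea_nonneg (φ : ℝ) : 0 ≤ capArea d φ := by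
  unfold capArea
  split_ifs
  · exact measureReal_nonneg
  · exact le_rfl

/-- The part of the unit cone at norm at least `cos φ ^ 2` fits in a ball of radius `sin φ` around
`cos φ • x`. The rest is a scaled copy of the cone, and solving for the area costs the factor `1 - ρ
^ d ≥ sin φ ^ 2`. -/
theorem capArea_mul_sin_sq_le (hd : 0 < d) {φ : ℝ} (hφ : φ ∈ Set.Ioo 0 (Real.pi / 2)) :
    capArea d φ * Real.sin φ ^ 2 ≤ Real.sin φ ^ d := by
  obtain ⟨hc0, hc1⟩ := cos_mem_Ioo hφ
  have hs0 := sin_pos_of_mem hφ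
  set x := pole d hd
  set V := volume.real (Metric.ball (0 : E) 1) with hV
  have hVpos : 0 < V := volume_ball_pos
  set ρ := Real.cos φ ^ 2 with hρ
  have hρ0 : 0 < ρ := by positivity
  have hρ1 : ρ < 1 := by nlinarith
  have hsub : truncatedCone φ x 1 ⊆
      truncatedCone φ x ρ ∪ Metric.closedBall (Real.cos φ • (x : E)) (Real.sin φ) := by
    rintro z ⟨h0, h1, h2⟩
    rcases lt_or_ge ‖z‖ ρ with h | h
    · exact Or.inl ⟨h0, h, h2⟩
    · refine Or.inr ?_
      rw [mem_closedBall_iff_norm]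
      refine le_of_sq_le_sq ?_ hs0.le
      rw [norm_sub_sq_real, inner_smul_right, norm_smul, norm_eq_of_mem_sphere, mul_one,
        Real.norm_eq_abs, abs_of_pos hc0, real_inner_comm, Real.sin_sq]
      nlinarith [mul_le_mul_of_nonneg_left h2 hc0.le, mul_nonneg (sub_nonneg.2 h1.le)
        (show 0 ≤ ‖z‖ + 1 - 2 * ρ by linarith)]
  have hle := (measureReal_mono (μ := volume) hsub (measure_union_ne_top
    (volume_truncatedCone_ne_top _ _ _) measure_closedBall_lt_top.ne)).trans
    (measureReal_union_le _ _)
  rw [volume_real_truncatedCone φ x hρ0, Measure.addHaar_real_closedBall _ _ hs0.le,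
    finrank_euclideanSpace_fin, ← capArea_mul_volume_ball hd φ x, ← hV] at hle
  have h1 : capArea d φ ≤ ρ ^ d * capArea d φ + Real.sin φ ^ d := by
    refine le_of_mul_le_mul_right ?_ hVpos
    linarith
  have h2 : ρ ^ d ≤ ρ := pow_le_of_le_one hρ0.le hρ1.le hd.ne'
  have h3 := mul_le_mul_of_nonneg_right h2 (capArea_nonneg (d := d) φ)
  rw [Real.sin_sq]
  linarith

/-- Volume of a ball of radius `sin φ` concentrates in a thin slab orthogonal to `x`, and with a
slight shift along `x` this slab lies in the cone of radius `1 + 7 * δ`. The two parts outside the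
slab fit in smaller balls. -/
theorem le_pow_mul_capArea (hd : 0 < d) {φ : ℝ} (hφ : φ ∈ Set.Ioo 0 (Real.pi / 2)) {δ : ℝ}
    (hδ0 : 0 < δ) (hδ1 : δ < 1) :
    Real.sin φ ^ d * (1 - 2 * (1 - δ ^ 2 / 2) ^ d) ≤ (1 + 7 * δ) ^ d * capArea d φ := by
  obtain ⟨hc0, hc1⟩ := cos_mem_Ioo hφ
  have hs0 := sin_pos_of_mem hφ
  have hsc := Real.sin_sq_add_cos_sq φ
  set x := pole d hd
  set s := Real.sin φ with hs
  set c := Real.cos φ with hc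
  set V := volume.real (Metric.ball (0 : E) 1) with hV
  have hVpos : 0 < V := volume_ball_pos
  obtain ⟨a, ha⟩ : ∃ a, a = c + δ * s := ⟨_, rfl⟩
  have hδ2 : δ ^ 2 < 1 := by nlinarith
  -- An upper bound for `s * √(1 - δ ^ 2)`, the radius of the disc cut out at height `δ * s`.
  obtain ⟨t, ht⟩ : ∃ t, t = s * (1 - δ ^ 2 / 2) := ⟨_, rfl⟩
  have ht0 : 0 < t := ht ▸ mul_pos hs0 (by linarith)
  have hts : s ^ 2 - δ ^ 2 * s ^ 2 ≤ t ^ 2 := by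
    rw [ht, mul_pow]
    nlinarith [mul_nonneg (sq_nonneg s) (sq_nonneg (δ ^ 2))]
  have hx : ‖(x : E)‖ = 1 := norm_eq_of_mem_sphere x
  have hsub : Metric.closedBall (a • (x : E)) s ⊆ truncatedCone φ x (1 + 7 * δ) ∪
      (Metric.closedBall ((a + 1 * (δ * s)) • (x : E)) t ∪
        Metric.closedBall ((a + -1 * (δ * s)) • (x : E)) t) := by
    intro z hz
    rw [mem_closedBall_iff_norm] at hz
    obtain ⟨w, rfl⟩ : ∃ w, z = a • (x : E) + w := ⟨z - a • (x : E), by abel⟩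
    rw [add_sub_cancel_left] at hz
    have hz2 : ‖w‖ ^ 2 ≤ s ^ 2 := pow_le_pow_left₀ (norm_nonneg _) hz 2
    have hfar : ∀ e : ℝ, e ^ 2 = 1 → δ * s ≤ e * inner ℝ (x : E) w →
        a • (x : E) + w ∈ Metric.closedBall ((a + e * (δ * s)) • (x : E)) t := by
      intro e he h1
      rw [mem_closedBall_iff_norm, add_smul, add_sub_add_left_eq_sub]
      refine le_of_sq_le_sq ?_ ht0.le
      rw [norm_sub_sq_real, inner_smul_right, norm_smul, hx, mul_one, real_inner_comm,
        Real.norm_eq_abs, sq_abs, mul_pow, he]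
      have h2 := mul_le_mul_of_nonneg_left h1 (mul_pos hδ0 hs0).le
      linarith
    by_cases h1 : δ * s ≤ inner ℝ (x : E) w
    · exact Or.inr (Or.inl (hfar 1 (by norm_num) (by linarith)))
    by_cases h2 : δ * s ≤ -inner ℝ (x : E) w
    · exact Or.inr (Or.inr (hfar (-1) (by norm_num) (by linarith)))
    exact Or.inl (slab_subset_cone hx hc0 hs0 hsc hδ0 ha hz (not_le.1 h1) (not_le.1 h2))
  have hle := (measureReal_mono (μ := volume) hsub (measure_union_ne_top
    (volume_truncatedCone_ne_top _ _ _) (measure_union_ne_top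
      measure_closedBall_lt_top.ne measure_closedBall_lt_top.ne))).trans
    ((measureReal_union_le _ _).trans (add_le_add le_rfl (measureReal_union_le _ _)))
  rw [volume_real_truncatedCone φ x (by linarith), Measure.addHaar_real_closedBall _ _ hs0.le,
    Measure.addHaar_real_closedBall _ _ ht0.le, Measure.addHaar_real_closedBall _ _ ht0.le,
    finrank_euclideanSpace_fin, ← capArea_mul_volume_ball hd φ x, ← hV, ht, mul_pow] at hle
  refine le_of_mul_le_mul_right ?_ hVpos
  linarith

end Caps

/-! ### Monotonicity of the mean under tilting -/

/-- The mean of the distribution on `ℕ` with weights proportional to `a n * x ^ n` is monotone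
in `x`. -/
theorem tsum_natCast_mul_div_tsum_le {a : ℕ → ℝ} (ha : ∀ n, 0 ≤ a n) {x y : ℝ} (hx : 0 < x)
    (hxy : x ≤ y) (hx0 : Summable fun n => a n * x ^ n)
    (hx1 : Summable fun n : ℕ => n * (a n * x ^ n)) (hy0 : Summable fun n => a n * y ^ n)
    (hy1 : Summable fun n : ℕ => n * (a n * y ^ n)) (hxpos : 0 < ∑' n, a n * x ^ n)
    (hypos : 0 < ∑' n, a n * y ^ n) :
    (∑' n : ℕ, n * (a n * x ^ n)) / (∑' n, a n * x ^ n) ≤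
      (∑' n : ℕ, n * (a n * y ^ n)) / (∑' n, a n * y ^ n) := by
  set m := (∑' n : ℕ, n * (a n * x ^ n)) / (∑' n, a n * x ^ n) with hm
  have hr1 : 1 ≤ y / x := (one_le_div hx).2 hxy
  have hr0 : 0 < y / x := by linarith
  -- Since `n - m` and `(y / x) ^ n - (y / x) ^ m` have the same sign, the tilt may be frozen at the
  -- mean `m`. The left side then sums to zero.
  have hpt : ∀ n : ℕ, (y / x) ^ m * (n * (a n * x ^ n) - m * (a n * x ^ n)) ≤
      n * (a n * y ^ n) - m * (a n * y ^ n) := by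
    intro n
    have h1 : a n * y ^ n = a n * x ^ n * (y / x) ^ (n : ℝ) := by
      rw [Real.rpow_natCast, div_pow]
      field_simp
    have h2 : 0 ≤ ((n : ℝ) - m) * ((y / x) ^ (n : ℝ) - (y / x) ^ m) := by
      rcases le_total (n : ℝ) m with h | h
      · exact mul_nonneg_of_nonpos_of_nonpos (by linarith)
          (by linarith [Real.rpow_le_rpow_of_exponent_le hr1 h])
      · exact mul_nonneg (by linarith) (by linarith [Real.rpow_le_rpow_of_exponent_le hr1 h])
    have h3 := mul_nonneg (mul_nonneg (ha n) (pow_nonneg hx.le n)) h2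
    rw [h1]
    linarith
  have hsum := ((hx1.sub (hx0.mul_left m)).mul_left ((y / x) ^ m)).tsum_le_tsum hpt
    (hy1.sub (hy0.mul_left m))
  rw [tsum_mul_left, hx1.tsum_sub (hx0.mul_left m), tsum_mul_left,
    hy1.tsum_sub (hy0.mul_left m), tsum_mul_left, hm, div_mul_cancel₀ _ hxpos.ne', sub_self,
    mul_zero, ← hm] at hsum
  rw [le_div_iff₀ hypos]
  linarith

/-! ### The hard cap model as a grand canonical sum -/

section Model

variable {d : ℕ} {θ : ℝ}

/-- Two points of the sphere are in conflict if their angle is less than `θ`. -/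
def Conflict (θ : ℝ) (x y : Sph d) : Prop :=
  Real.cos θ < inner ℝ (x : EuclideanSpace ℝ (Fin d)) (y : EuclideanSpace ℝ (Fin d))

theorem measurableSet_conflict (d : ℕ) (θ : ℝ) :
    MeasurableSet {p : Sph d × Sph d | Conflict θ p.1 p.2} :=
  measurableSet_lt measurable_const
    ((continuous_subtype_val.comp continuous_fst).inner
      (continuous_subtype_val.comp continuous_snd)).measurable

theorem Conflict.symm {x y : Sph d} (h : Conflict θ x y) : Conflict θ y x := by
  rwa [Conflict, real_inner_comm]

theorem mem_codes_iff (X : Config d) : X ∈ codes d θ ↔ IsCode (Conflict θ) X.2 := by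
  simp [codes, IsCode, Conflict]

theorem measurable_config {B : Type*} [MeasurableSpace B] {f : Config d → B}
    (h : ∀ n, Measurable fun x : Fin n → Sph d => f ⟨n, x⟩) : Measurable f := fun _ hs =>
  MeasurableSpace.measurableSet_iInf.2 fun n => h n hs

theorem measurable_config_mk (n : ℕ) :
    Measurable fun x : Fin n → Sph d => (⟨n, x⟩ : Config d) := fun _ hs =>
  MeasurableSpace.measurableSet_iInf.1 hs n

theorem lintegral_poissonProcess (lam : ℝ≥0) {f : Config d → ℝ≥0∞} (hf : Measurable f) :
    ∫⁻ X, f X ∂(poissonProcess d lam) =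
      ENNReal.ofReal (Real.exp (-lam)) * gcSum (surf d) lam fun n x => f ⟨n, x⟩ := by
  rw [poissonProcess, lintegral_sum_measure, gcSum, ← ENNReal.tsum_mul_left]
  congr with n
  rw [lintegral_smul_measure, lintegral_map hf (measurable_config_mk n), smul_eq_mul, ← mul_assoc,
    poissonMeasure_singleton, mul_div_assoc, ENNReal.ofReal_mul (Real.exp_pos _).le,
    ENNReal.ofReal_div_of_pos (by positivity), ENNReal.ofReal_pow lam.coe_nonneg,
    ENNReal.ofReal_coe_nnreal, ENNReal.ofReal_natCast]

variable (d θ) in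
/-- The probability that `n` independent uniform points of the sphere form a spherical code. -/
def codeProb (n : ℕ) : ℝ :=
  (∫⁻ x : Fin n → Sph d, ind (IsCode (Conflict θ) x) ∂Measure.pi fun _ => surf d).toReal

theorem lintegral_ind_isCode_le_one (hd : 0 < d) (n : ℕ) :
    ∫⁻ x : Fin n → Sph d, ind (IsCode (Conflict θ) x) ∂(Measure.pi fun _ => surf d) ≤ 1 := by
  have := isProbabilityMeasure_surf hd
  calc _ ≤ ∫⁻ _ : Fin n → Sph d, 1 ∂(Measure.pi fun _ => surf d) :=
        lintegral_mono fun _ => ind_le_one _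
    _ = 1 := by simp

theorem codeProb_nonneg (n : ℕ) : 0 ≤ codeProb d θ n := ENNReal.toReal_nonneg

theorem codeProb_le_one (hd : 0 < d) (n : ℕ) : codeProb d θ n ≤ 1 :=
  ENNReal.toReal_le_of_le_ofReal zero_le_one (by simpa using lintegral_ind_isCode_le_one hd n)

theorem codeProb_zero : codeProb d θ 0 = 1 := by
  have h : ∀ x : Fin 0 → Sph d, ind (IsCode (Conflict θ) x) = 1 := fun x =>
    ind_of_true fun i => i.elim0
  simp [codeProb, h]

theorem summable_codeProb (hd : 0 < d) (x : ℝ≥0) :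
    Summable fun n => codeProb d θ n / n.factorial * (x : ℝ) ^ n := by
  refine Summable.of_nonneg_of_le (fun n => ?_) (fun n => ?_)
    (Real.summable_pow_div_factorial (x : ℝ))
  · have := codeProb_nonneg (d := d) (θ := θ) n
    positivity
  · have := mul_le_mul_of_nonneg_right (codeProb_le_one (θ := θ) hd n)
      (show 0 ≤ (x : ℝ) ^ n / n.factorial by positivity)
    calc _ = codeProb d θ n * ((x : ℝ) ^ n / n.factorial) := by ring
      _ ≤ _ := by rwa [one_mul] at this

theorem summable_natCast_mul_codeProb (hd : 0 < d) (x : ℝ≥0) :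
    Summable fun n : ℕ => n * (codeProb d θ n / n.factorial * (x : ℝ) ^ n) := by
  rw [← summable_nat_add_iff 1]
  refine Summable.of_nonneg_of_le (fun n => ?_) (fun n => ?_)
    ((Real.summable_pow_div_factorial (x : ℝ)).mul_left (x : ℝ))
  · have := codeProb_nonneg (d := d) (θ := θ) (n + 1)
    positivity
  · have h := mul_le_mul_of_nonneg_right (codeProb_le_one (θ := θ) hd (n + 1))
      (show 0 ≤ (x : ℝ) * ((x : ℝ) ^ n / n.factorial) by positivity)
    rw [one_mul] at h
    refine le_trans (le_of_eq ?_) h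
    rw [Nat.factorial_succ]
    push_cast
    field_simp
    ring

variable (d θ) in
/-- The grand canonical partition function. -/
def partitionFun (x : ℝ) : ℝ := ∑' n : ℕ, codeProb d θ n / n.factorial * x ^ n

variable (d θ) in
/-- The unnormalized mean number of points. -/
def sizeSum (x : ℝ) : ℝ := ∑' n : ℕ, n * (codeProb d θ n / n.factorial * x ^ n)

theorem partitionFun_pos (hd : 0 < d) (x : ℝ≥0) : 0 < partitionFun d θ x := by
  refine (summable_codeProb hd x).tsum_pos (fun n => ?_) 0 ?_
  · have := codeProb_nonneg (d := d) (θ := θ) n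
    positivity
  · simp [codeProb_zero]

theorem sizeSum_nonneg (x : ℝ≥0) : 0 ≤ sizeSum d θ x :=
  tsum_nonneg fun n => by
    have := codeProb_nonneg (d := d) (θ := θ) n
    positivity

theorem gcSum_ind_isCode (hd : 0 < d) (lam : ℝ≥0) :
    gcSum (surf d) lam (fun _ x => ind (IsCode (Conflict θ) x)) =
      ENNReal.ofReal (partitionFun d θ lam) := by
  rw [partitionFun, ENNReal.ofReal_tsum_of_nonneg (fun n => ?_) (summable_codeProb hd lam), gcSum]
  · congr with n
    rw [mul_comm, div_mul_eq_mul_div, mul_div_assoc, ENNReal.ofReal_mul (codeProb_nonneg n),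
      codeProb, ENNReal.ofReal_toReal
        (ne_top_of_le_ne_top ENNReal.one_ne_top (lintegral_ind_isCode_le_one hd n)),
      ENNReal.ofReal_div_of_pos (by positivity), ENNReal.ofReal_pow lam.coe_nonneg,
      ENNReal.ofReal_coe_nnreal, ENNReal.ofReal_natCast]
  · have := codeProb_nonneg (d := d) (θ := θ) n
    positivity

theorem gcSum_ind_isCode_mul_natCast (hd : 0 < d) (lam : ℝ≥0) :
    gcSum (surf d) lam (fun n x => ind (IsCode (Conflict θ) x) * n) =
      ENNReal.ofReal (sizeSum d θ lam) := by
  rw [sizeSum, ENNReal.ofReal_tsum_of_nonneg (fun n => ?_) (summable_natCast_mul_codeProb hd lam),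
    gcSum]
  · congr with n
    rw [lintegral_mul_const _ (measurable_ind_isCode (measurableSet_conflict d θ) n),
      ENNReal.ofReal_mul (by positivity), div_mul_eq_mul_div, mul_div_assoc,
      ENNReal.ofReal_mul (codeProb_nonneg n),
      codeProb, ENNReal.ofReal_toReal
        (ne_top_of_le_ne_top ENNReal.one_ne_top (lintegral_ind_isCode_le_one hd n)),
      ENNReal.ofReal_div_of_pos (by positivity), ENNReal.ofReal_pow lam.coe_nonneg,
      ENNReal.ofReal_coe_nnreal, ENNReal.ofReal_natCast, ENNReal.ofReal_natCast]
    ring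
  · have := codeProb_nonneg (d := d) (θ := θ) n
    positivity

/-- The Poisson factor `exp (-lam)` cancels between the integral over the codes and their total
mass. -/
theorem expectedSize_eq (hd : 0 < d) (lam : ℝ≥0) :
    expectedSize d θ lam = sizeSum d θ lam / partitionFun d θ lam := by
  have hcodes : MeasurableSet (codes d θ) := by
    have h : Measurable fun X : Config d => ind (X ∈ codes d θ) :=
      measurable_config fun n => by
        simp only [mem_codes_iff]
        exact measurable_ind_isCode (measurableSet_conflict d θ) n
    have h' : codes d θ = (fun X : Config d => ind (X ∈ codes d θ)) ⁻¹' {1} := by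
      ext X
      by_cases hX : X ∈ codes d θ <;> simp [hX, ind]
    rw [h']
    exact h (measurableSet_singleton 1)
  have hind : Measurable fun X : Config d => ind (X ∈ codes d θ) := measurable_ind hcodes
  have hsize : Measurable fun X : Config d => (X.1 : ℝ≥0∞) :=
    measurable_config fun n => measurable_const (a := (n : ℝ≥0∞))
  have hmass : poissonProcess d lam (codes d θ) =
      ENNReal.ofReal (Real.exp (-lam)) * ENNReal.ofReal (partitionFun d θ lam) := by
    rw [← lintegral_ind_mem _ hcodes, lintegral_poissonProcess lam hind, ← gcSum_ind_isCode hd]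
    simp only [mem_codes_iff]
  have hnum : ∫⁻ X in codes d θ, (X.1 : ℝ≥0∞) ∂(poissonProcess d lam) =
      ENNReal.ofReal (Real.exp (-lam)) * ENNReal.ofReal (sizeSum d θ lam) := by
    have h : ∀ X : Config d, (codes d θ).indicator (fun X => (X.1 : ℝ≥0∞)) X =
        ind (X ∈ codes d θ) * X.1 := fun X => by
      by_cases hX : X ∈ codes d θ
      · rw [Set.indicator_of_mem hX, ind_of_true hX, one_mul]
      · rw [Set.indicator_of_notMem hX, ind_of_false hX, zero_mul]
    have hm : Measurable fun X : Config d => ind (X ∈ codes d θ) * X.1 := hind.mul hsize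
    rw [← lintegral_indicator hcodes, lintegral_congr h, lintegral_poissonProcess lam hm,
      ← gcSum_ind_isCode_mul_natCast hd]
    simp only [mem_codes_iff]
  have hreal : Measurable fun X : Config d => (X.1 : ℝ) :=
    measurable_config fun n => measurable_const (a := (n : ℝ))
  rw [expectedSize, integral_eq_lintegral_of_nonneg_ae (ae_of_all _ fun X => Nat.cast_nonneg _)
    hreal.aestronglyMeasurable]
  simp only [ENNReal.ofReal_natCast]
  rw [hardCap, ProbabilityTheory.cond, lintegral_smul_measure, hnum, hmass, smul_eq_mul,
    ENNReal.toReal_mul, ENNReal.toReal_inv, ENNReal.toReal_mul, ENNReal.toReal_mul,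
    ENNReal.toReal_ofReal (Real.exp_pos _).le, ENNReal.toReal_ofReal (partitionFun_pos hd lam).le,
    ENNReal.toReal_ofReal (sizeSum_nonneg lam)]
  have := Real.exp_pos (-(lam : ℝ))
  have := partitionFun_pos (θ := θ) hd lam
  field_simp

theorem expectedSize_nonneg (lam : ℝ≥0) : 0 ≤ expectedSize d θ lam :=
  integral_nonneg fun _ => Nat.cast_nonneg _

theorem expectedSize_mono (hd : 0 < d) {x y : ℝ≥0} (hxy : x ≤ y) :
    expectedSize d θ x ≤ expectedSize d θ y := by
  -- Tilting divides by `x`, so zero fugacity is separate.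
  rcases eq_or_ne x 0 with rfl | hx
  · refine le_trans (le_of_eq ?_) (expectedSize_nonneg y)
    rw [expectedSize_eq hd, sizeSum]
    have h : ∀ n : ℕ, (n : ℝ) * (codeProb d θ n / n.factorial * ((0 : ℝ≥0) : ℝ) ^ n) = 0 := by
      intro n
      cases n <;> simp
    rw [tsum_congr h, tsum_zero, zero_div]
  · rw [expectedSize_eq hd, expectedSize_eq hd]
    exact tsum_natCast_mul_div_tsum_le
      (fun n => div_nonneg (codeProb_nonneg n) (Nat.cast_nonneg _))
      (NNReal.coe_pos.2 (pos_iff_ne_zero.2 hx)) (NNReal.coe_le_coe.2 hxy)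
      (summable_codeProb hd x) (summable_natCast_mul_codeProb hd x)
      (summable_codeProb hd y) (summable_natCast_mul_codeProb hd y)
      (partitionFun_pos hd x) (partitionFun_pos hd y)

/-- The lower bound for the mean size of a random spherical code, with a free parameter `t`. -/
theorem le_expectedSize (hd : 0 < d) (hθ : θ ∈ Set.Ioo 0 (Real.pi / 2)) {lam : ℝ≥0}
    {κ : ℝ} (hκ0 : 0 < κ) (hκ : 2 * (lam * capArea d (q θ)) ≤ 1 - κ) (t : ℝ) :
    Real.exp (-t) * (1 + t) * lam ≤
      (1 + Real.exp (-t) * κ⁻¹ * lam * capArea d θ) * expectedSize d θ lam := by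
  have hprob := isProbabilityMeasure_surf hd
  have hq0 := capArea_nonneg (d := d) (q θ)
  have hs0 := capArea_nonneg (d := d) θ
  have hκ1 : κ ≤ 1 := by
    have : 0 ≤ (lam : ℝ) * capArea d (q θ) := by positivity
    linarith
  have hsurf : ∀ φ (x : Sph d), surf d (cap φ x) = ENNReal.ofReal (capArea d φ) := fun φ x => by
    rw [capArea_eq φ x, Measure.real, ENNReal.ofReal_toReal (measure_ne_top _ _)]
  have hs : ∀ y : Sph d, surf d {v | Conflict θ v y} ≤ ENNReal.ofReal (capArea d θ) := fun y => by
    rw [← hsurf θ y]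
    exact measure_mono fun v hv => (Conflict.symm hv).le
  have hb : ∀ v : Sph d, ∀ T : Set (Sph d), MeasurableSet T → (∀ y ∈ T, Conflict θ v y) →
      ∫⁻ z in T, surf d (T ∩ {y | Conflict θ z y}) ∂surf d ≤
        2 * ENNReal.ofReal (capArea d (q θ)) * surf d T := by
    intro v T _ hT
    refine lintegral_measure_inter_le (measurableSet_conflict d θ) (fun _ _ h => h.symm)
      -- Order by closeness to `v`: the points in conflict with `y` and at least as close to `v`
      -- form the lens.
      (ρ := fun z => inner ℝ (v : EuclideanSpace ℝ (Fin d)) (z : EuclideanSpace ℝ (Fin d)))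
      (continuous_const.inner continuous_subtype_val).measurable fun y hy => ?_
    obtain ⟨m, hm⟩ := exists_lens_subset_cap hθ v y (hT y hy).le
    rw [← hsurf (q θ) m]
    exact measure_mono hm
  have hκ' : (lam : ℝ≥0∞) * (2 * ENNReal.ofReal (capArea d (q θ))) ≤ ENNReal.ofReal (1 - κ) := by
    rw [← ENNReal.ofReal_coe_nnreal, ← ENNReal.ofReal_ofNat 2, ← ENNReal.ofReal_mul zero_le_two,
      ← ENNReal.ofReal_mul lam.coe_nonneg]
    exact ENNReal.ofReal_le_ofReal (by linarith)
  have h := gcSum_code_le_gcSum_size (measurableSet_conflict d θ) (fun _ _ h => h.symm)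
    (lam := lam) ENNReal.coe_ne_top hs hb hκ0 hκ1 hκ' t
  have hA := sizeSum_nonneg (d := d) (θ := θ) lam
  have hZ := partitionFun_pos (θ := θ) hd lam
  have he := Real.exp_pos (-t)
  rw [gcSum_ind_isCode hd, gcSum_ind_isCode_mul_natCast hd, ← ENNReal.ofReal_coe_nnreal,
    ← ENNReal.ofReal_mul lam.coe_nonneg, ← ENNReal.ofReal_mul' (by positivity),
    ← ENNReal.ofReal_mul he.le, ← ENNReal.ofReal_mul (by positivity),
    ← ENNReal.ofReal_mul (by positivity), ← ENNReal.ofReal_mul (by positivity),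
    ← ENNReal.ofReal_add hA (by positivity), ENNReal.ofReal_le_ofReal_iff (by positivity)] at h
  rw [expectedSize_eq hd, mul_div_assoc', le_div_iff₀ hZ]
  linarith

end Model

/-! ### Exponential decay of the area ratio and choice of `t` -/

section Asymptotics

variable {θ : ℝ}

theorem eventually_le_capArea {φ : ℝ} (hφ : φ ∈ Set.Ioo 0 (Real.pi / 2)) {δ : ℝ} (hδ0 : 0 < δ)
    (hδ1 : δ < 1) :
    ∀ᶠ d : ℕ in atTop, Real.sin φ ^ d / 2 ≤ (1 + 7 * δ) ^ d * capArea d φ := by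
  have hδ2 : δ ^ 2 < 1 := by nlinarith
  have h := tendsto_pow_atTop_nhds_zero_of_lt_one (r := 1 - δ ^ 2 / 2) (by linarith)
    (by linarith [pow_pos hδ0 2])
  filter_upwards [h.eventually (gt_mem_nhds (show (0 : ℝ) < 1 / 4 by norm_num)),
    eventually_gt_atTop 0] with d hd hd0
  refine le_trans ?_ (le_pow_mul_capArea hd0 hφ hδ0 hδ1)
  rw [div_eq_mul_inv]
  exact mul_le_mul_of_nonneg_left (by norm_num; linarith)
    (pow_nonneg (sin_pos_of_mem hφ).le d)

theorem eventually_capArea_pos {φ : ℝ} (hφ : φ ∈ Set.Ioo 0 (Real.pi / 2)) :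
    ∀ᶠ d : ℕ in atTop, 0 < capArea d φ := by
  filter_upwards [eventually_le_capArea hφ (δ := 1 / 2) (by norm_num) (by norm_num)] with d hd
  have := pow_pos (sin_pos_of_mem hφ) d
  exact pos_of_mul_pos_right (lt_of_lt_of_le (by positivity) hd) (by positivity)

/-- The ratio of the areas of the caps of radii `q θ` and `θ` decays exponentially with any rate
less than `c θ`. -/
theorem tendsto_exp_mul_capArea_div (hθ : θ ∈ Set.Ioo 0 (Real.pi / 2)) {x : ℝ} (hx : 0 < x) :
    Tendsto (fun d : ℕ => Real.exp ((c θ - x) * d) * (d * capArea d (q θ) / capArea d θ))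
      atTop (𝓝 0) := by
  have hq := q_mem_Ioo hθ
  have hs := sin_pos_of_mem hθ
  have hsq := sin_pos_of_mem hq
  -- The loss `(1 + 7 * δ) ^ d` in the cap estimate must be beaten by the slack `exp (-x * d)`.
  obtain ⟨δ, hδ0, hδ1, hδx⟩ : ∃ δ : ℝ, 0 < δ ∧ δ < 1 ∧ 1 + 7 * δ < Real.exp x := by
    refine ⟨min (1 / 2) (x / 14), by positivity, (min_le_left _ _).trans_lt (by norm_num), ?_⟩
    have h1 := min_le_right (1 / 2) (x / 14)
    have h2 := Real.add_one_le_exp x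
    linarith
  set r := (1 + 7 * δ) * Real.exp (-x) with hr
  have hr0 : 0 < r := by positivity
  have hr1 : r < 1 := by
    rw [hr, Real.exp_neg, ← div_eq_mul_inv, div_lt_one (Real.exp_pos x)]
    exact hδx
  have hlim := (tendsto_self_mul_const_pow_of_lt_one hr0.le hr1).const_mul
    (2 / Real.sin (q θ) ^ 2)
  rw [mul_zero] at hlim
  refine squeeze_zero' (Eventually.of_forall fun d => ?_) ?_ hlim
  · have := capArea_nonneg (d := d) (q θ)
    have := capArea_nonneg (d := d) θ
    positivity
  · filter_upwards [eventually_le_capArea hθ hδ0 hδ1, eventually_capArea_pos hθ,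
      eventually_gt_atTop 0] with d hd hpos hd0
    have hup : capArea d (q θ) ≤ Real.sin (q θ) ^ d / Real.sin (q θ) ^ 2 := by
      rw [le_div_iff₀ (by positivity)]
      exact capArea_mul_sin_sq_le hd0 hq
    have hexp : Real.exp ((c θ - x) * d) =
        (Real.sin θ ^ d / Real.sin (q θ) ^ d) * Real.exp (-x) ^ d := by
      rw [← Real.exp_nat_mul, ← div_pow, ← Real.exp_log (div_pos hs hsq), ← Real.exp_nat_mul,
        ← Real.exp_add]
      congr 1
      rw [c]
      ring
    rw [mul_div_assoc', div_le_iff₀ hpos, hexp]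
    calc Real.sin θ ^ d / Real.sin (q θ) ^ d * Real.exp (-x) ^ d * (d * capArea d (q θ))
        ≤ Real.sin θ ^ d / Real.sin (q θ) ^ d * Real.exp (-x) ^ d *
            (d * (Real.sin (q θ) ^ d / Real.sin (q θ) ^ 2)) := by gcongr
      _ = 2 / Real.sin (q θ) ^ 2 * d * Real.exp (-x) ^ d * (Real.sin θ ^ d / 2) := by
          field_simp
      _ ≤ 2 / Real.sin (q θ) ^ 2 * d * Real.exp (-x) ^ d * ((1 + 7 * δ) ^ d * capArea d θ) := by
          gcongr
      _ = 2 / Real.sin (q θ) ^ 2 * (d * r ^ d) * capArea d θ := by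
          rw [hr, mul_pow]
          ring

/-- The fugacity `1 / (d * s_d(q θ))`. -/
def thresholdFugacity (d : ℕ) (θ : ℝ) : ℝ≥0 := (1 / ((d : ℝ) * capArea d (q θ))).toNNReal

theorem eventually_le_expectedSize (hθ : θ ∈ Set.Ioo 0 (Real.pi / 2)) {η : ℝ} (hη0 : 0 < η)
    (hη1 : η < 1) :
    ∀ᶠ d : ℕ in atTop,
      (1 - η) * (c θ * d) ≤ expectedSize d θ (thresholdFugacity d θ) * capArea d θ := by
  have hc := c_pos hθ
  have hlim1 := tendsto_exp_mul_capArea_div hθ (x := η / 2 * c θ) (by positivity)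
  have hlim2 : Tendsto (fun d : ℕ => (1 - 2 / (d : ℝ))⁻¹) atTop (𝓝 1) := by
    have h := (tendsto_const_div_atTop_nhds_zero_nat (2 : ℝ)).const_sub 1
    rw [sub_zero] at h
    simpa using h.inv₀ one_ne_zero
  have hlim := hlim1.add hlim2
  rw [zero_add] at hlim
  filter_upwards [hlim.eventually (gt_mem_nhds (show (1 : ℝ) < 1 + η / 2 by linarith)),
    eventually_capArea_pos hθ, eventually_capArea_pos (q_mem_Ioo hθ),
    eventually_gt_atTop 2] with d hd ha hb hd2
  have hd0 : (2 : ℝ) < d := by exact_mod_cast hd2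
  have hd0' : (0 : ℝ) < d := by linarith
  have hlam : (thresholdFugacity d θ : ℝ) = 1 / (d * capArea d (q θ)) :=
    Real.coe_toNNReal _ (by positivity)
  have hκ0 : 0 < 1 - 2 / (d : ℝ) := by
    rw [sub_pos, div_lt_one hd0']
    exact hd0
  have hα := expectedSize_nonneg (d := d) (θ := θ) (thresholdFugacity d θ)
  set α := expectedSize d θ (thresholdFugacity d θ)
  -- Just below `c θ * d`, so `exp t * d` times the ratio of areas still tends to zero.
  set t := (c θ - η / 2 * c θ) * d with ht
  have h := le_expectedSize (d := d) (lam := thresholdFugacity d θ) (by omega) hθ hκ0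
    (by rw [hlam]; field_simp; linarith) t
  rw [hlam] at h
  -- The bound of `le_expectedSize` multiplied by `exp t / lam`; the bracket tends to `1`.
  have h1 : 1 + t ≤ (Real.exp t * (d * capArea d (q θ) / capArea d θ) + (1 - 2 / (d : ℝ))⁻¹) *
      (α * capArea d θ) := by
    have h2 := mul_le_mul_of_nonneg_left h
      (show 0 ≤ Real.exp t * (d * capArea d (q θ)) by positivity)
    have h3 : Real.exp t * Real.exp (-t) = 1 := by rw [← Real.exp_add]; simp
    have h4 : Real.exp t * (d * capArea d (q θ)) *
        (Real.exp (-t) * (1 + t) * (1 / (d * capArea d (q θ)))) = 1 + t := by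
      calc _ = Real.exp t * Real.exp (-t) * (1 + t) *
            ((d * capArea d (q θ)) * (1 / (d * capArea d (q θ)))) := by ring
        _ = 1 + t := by rw [h3, mul_one_div_cancel (by positivity)]; ring
    have h5 : Real.exp t * (d * capArea d (q θ)) * ((1 + Real.exp (-t) * (1 - 2 / (d : ℝ))⁻¹ *
          (1 / (d * capArea d (q θ))) * capArea d θ) * α) =
        (Real.exp t * (d * capArea d (q θ) / capArea d θ) + (1 - 2 / (d : ℝ))⁻¹) *
          (α * capArea d θ) := by
      calc _ = (Real.exp t * (d * capArea d (q θ)) + Real.exp t * Real.exp (-t) *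
            ((d * capArea d (q θ)) * (1 / (d * capArea d (q θ)))) * (1 - 2 / (d : ℝ))⁻¹ *
              capArea d θ) * α := by ring
        _ = _ := by
          rw [h3, mul_one_div_cancel (by positivity)]
          linear_combination (-Real.exp t * α) *
            div_mul_cancel₀ (d * capArea d (q θ)) ha.ne'
    linarith
  have h2 : 1 + t ≤ (1 + η / 2) * (α * capArea d θ) :=
    h1.trans (mul_le_mul_of_nonneg_right hd.le (by positivity))
  -- Here `(1 - η) * (1 + η / 2) ≤ 1 - η / 2`.
  have h3 : (1 - η) * (c θ * d) * (1 + η / 2) ≤ 1 + t := by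
    have : 0 ≤ c θ * d * η ^ 2 := by positivity
    rw [ht]
    nlinarith
  refine le_of_mul_le_mul_right ?_ (show 0 < 1 + η / 2 by linarith)
  linarith

end Asymptotics

end HardCap

end

theorem theorem4 (θ : ℝ) (hθ : θ ∈ Set.Ioo 0 (Real.pi / 2)) :
    ∃ ε : ℕ → ℝ, Tendsto ε atTop (𝓝 0) ∧
      ∀ d : ℕ, 2 ≤ d → ∀ lam : ℝ≥0,
        1 / ((d : ℝ) * HardCap.capArea d (HardCap.q θ)) ≤ (lam : ℝ) →
          (1 + ε d) * (HardCap.c θ * d / HardCap.capArea d θ) ≤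
            HardCap.expectedSize d θ lam := by
  have hc := HardCap.c_pos hθ
  -- The relative error at the threshold fugacity, cut off at zero because only a lower bound for it
  -- is known.
  refine ⟨fun d => min 0 (HardCap.expectedSize d θ (HardCap.thresholdFugacity d θ) *
    HardCap.capArea d θ / (HardCap.c θ * d) - 1), ?_, ?_⟩
  · rw [Metric.tendsto_atTop']
    intro η hη
    have hη' : 0 < min (η / 2) (1 / 2) := by positivity
    obtain ⟨N, hN⟩ := eventually_atTop.1 (HardCap.eventually_le_expectedSize hθ hη'
      ((min_le_right _ _).trans_lt (by norm_num)))
    refine ⟨N, fun d hd => ?_⟩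
    have hd0 : (0 : ℝ) < d := by exact_mod_cast (Nat.zero_le N).trans_lt hd
    have h := hN d hd.le
    rw [← le_div_iff₀ (by positivity)] at h
    rw [Real.dist_eq, sub_zero, abs_of_nonpos (min_le_left _ _), neg_lt, lt_min_iff]
    have := min_le_left (η / 2) (1 / 2)
    exact ⟨by linarith, by linarith⟩
  · intro d hd lam hlam
    dsimp only
    refine le_trans ?_ (HardCap.expectedSize_mono (x := HardCap.thresholdFugacity d θ)
      (by omega) (Real.toNNReal_le_iff_le_coe.2 hlam))
    have hd0 : (0 : ℝ) < d := by exact_mod_cast (by omega : 0 < d)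
    rcases (HardCap.capArea_nonneg (d := d) θ).eq_or_lt with ha | ha
    -- Positivity of the cap area is only known for large `d`; if the area were zero, the left side
    -- would be zero by convention.
    · rw [← ha, div_zero, mul_zero]
      exact HardCap.expectedSize_nonneg _
    · rw [mul_div_assoc', div_le_iff₀ ha, ← le_div_iff₀ (by positivity)]
      linarith [min_le_right 0 (HardCap.expectedSize d θ (HardCap.thresholdFugacity d θ) *
        HardCap.capArea d θ / (HardCap.c θ * d) - 1)]
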